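/- Let $q>1$, $\gamma\in\mathbb R$ and $c=q^{-2\gamma}$. Write $(a;p)_n=\prod_{i=0}^{n-1}(1-ap^i)$, $(a;p)_\infty=\prod_{i\ge0}(1-ap^i)$, $(a_1,\dots,a_r;p)_\infty=\prod_j(a_j;p)_\infty$, and let ${}_2\varphi_1(a,b;0;p,z)$ denote the analytic continuation to $\mathbb C\setminus[1,\infty)$ of $\sum_{n\ge0}\frac{(a;p)_n(b;p)_n}{(p;p)_n}z^n$. On the extended lattice $x=x_{\sigma,k}=\sigma\sqrt c\,q^{-2k}$ ($\sigma=\pm1$, $k\in\mathbb Z$) define, for $m\in\mathbb Z$, $n\in\mathbb N=\{0,1,2,\dots\}$ and $\varepsilon_m=q^{2\gamma-2m}$, $$\tilde k_m(x_{\sigma,k})=\sigma^{m+1}(-\varepsilon_m)^k\,{}_2\varphi_1\Big(-q^{2m-2\gamma-2},-q^{2m-2\gamma};0;q^{-4},-\frac{q^{-4}}{x^2}\Big),\qquad \tilde h_n(x)=x^n\,{}_2\varphi_1\Big(q^{2n-2},q^{2n};0;q^{-4},-\frac{q^{-4}}{x^2}\Big),$$ and put $M_c=\dfrac{(q^{-4},q^{-4},-c^{-1}q^{-2},-cq^{-2};q^{-4})_\infty}{(-c,-c^{-1}q^{-4};q^{-4})_\infty}$.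 Then $\tilde k_m$ and $\tilde h_n$ are real on the lattice, each $\tilde k_m$ solves the eigenvalue equation $$\big(q+q^{-1}-q\,\varepsilon_m x^2\big)g(x)-q^{-1}g(q^2x)-q(1+x^2)\,g(q^{-2}x)=0$$ at every point $x$ of the lattice, and for all $m,n\in\mathbb Z$ $$\sum_{k\in\mathbb Z,\ \sigma=\pm1}\frac{\tilde k_m(\sigma\sqrt c\,q^{-2k})\,\tilde k_n(\sigma\sqrt c\,q^{-2k})}{(-cq^{-4k};q^{-4})_\infty}\,q^{-2k}=2M_c\,\frac{c^mq^{2m^2}}{(-c^{-1}q^{-2m-2};q^{-2})_\infty}\,\delta_{mn},$$ and for all $n\in\mathbb N$, $m\in\mathbb Z$ $$\sum_{k\in\mathbb Z,\ \sigma=\pm1}\frac{\tilde h_n(\sigma\sqrt c\,q^{-2k})\,\tilde k_m(\sigma\sqrt c\,q^{-2k})}{(-cq^{-4k};q^{-4})_\infty}\,q^{-2k}=0,$$ all sums converging absolutely. Moreover, the orthogonality relation for the $\tilde k_m$, with the same norms, also holds if the prefactor $\sigma^{m+1}(-\varepsilon_m)^k$ is replaced by $(-x)^{m-\gamma}\sqrt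 c^{\,\gamma-m}$ (principal value of the power) and the first factor in the sum is complex conjugated. -/

import Mathlib

namespace QOscillator

/-- The finite `q`-shifted factorial `(a;q)_n = ∏_{i<n} (1 - a q^i)`. -/
noncomputable def qPoch {R : Type*} [CommRing R] (a q : R) (n : ℕ) : R :=
  ∏ i ∈ Finset.range n, (1 - a * q ^ i)

/-- The infinite `q`-shifted factorial `(a;q)_∞ = ∏_{i≥0} (1 - a q^i)`, for `|q| < 1`. -/
noncomputable def qPochInf {R : Type*} [CommRing R] [TopologicalSpace R] (a q : R) : R :=
  ∏' i : ℕ, (1 - a * q ^ i)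

/-- `F` is holomorphic on `ℂ \ [1,∞)` and equals there, inside the unit disc, the sum of the basic
hypergeometric series `∑_n (a;q)_n (b;q)_n / ((c;q)_n (q;q)_n) z^n`. -/
def IsPhi21 (a b c q : ℂ) (F : ℂ → ℂ) : Prop :=
  DifferentiableOn ℂ F {z : ℂ | 1 - z ∈ Complex.slitPlane} ∧
    ∀ z : ℂ, ‖z‖ < 1 →
      HasSum (fun n : ℕ => qPoch a q n * qPoch b q n / (qPoch c q n * qPoch q q n) * z ^ n) (F z)

open Classical in
/-- The basic hypergeometric function `₂φ₁(a,b;c;q,z)`: the analytic continuation to `ℂ \ [1,∞)` of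
its defining series.  By the identity theorem, its values on `ℂ \ [1,∞)` do not depend on the
choice of `F`. -/
noncomputable def phi21 (a b c q z : ℂ) : ℂ :=
  if h : ∃ F : ℂ → ℂ, IsPhi21 a b c q F then h.choose z else 0

/-- The constant `c = q^{-2γ}`. -/
noncomputable def cst (q γ : ℝ) : ℝ := q ^ (-2 * γ)

/-- The lattice point `σ √c q^{-2k}`, with `σ = ±1` and `k ∈ ℤ`. -/
noncomputable def pt (q γ : ℝ) (σ : ℤˣ) (k : ℤ) : ℝ :=
  ((σ : ℤ) : ℝ) * √(cst q γ) * q ^ (-2 * k)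

/-- The weight `q^{-2k} / (-c q^{-4k}; q^{-4})_∞`. -/
noncomputable def weight (q γ : ℝ) (k : ℤ) : ℝ :=
  q ^ (-2 * k) / qPochInf (-(cst q γ * q ^ (-4 * k))) (q ^ (-4 : ℤ))

/-- The polynomial part `h̃_n(x) = x^n ₂φ₁(q^{2n-2}, q^{2n}; 0; q^{-4}, -q^{-4}/x²)` of the Fock
eigenfunctions. -/
noncomputable def hTilde (q : ℝ) (n : ℕ) (x : ℝ) : ℂ :=
  ((x ^ n : ℝ) : ℂ) *
    phi21 ((q ^ (2 * (n : ℤ) - 2) : ℝ) : ℂ) ((q ^ (2 * (n : ℤ)) : ℝ) : ℂ) 0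
      ((q ^ (-4 : ℤ) : ℝ) : ℂ) ((-(q ^ (-4 : ℤ) / x ^ 2) : ℝ) : ℂ)

/-- The factor `₂φ₁(-q^{2m-2γ-2}, -q^{2m-2γ}; 0; q^{-4}, -q^{-4}/x²)`. -/
noncomputable def kPhi (q γ : ℝ) (m : ℤ) (x : ℝ) : ℂ :=
  phi21 ((-q ^ (2 * (m : ℝ) - 2 * γ - 2) : ℝ) : ℂ) ((-q ^ (2 * (m : ℝ) - 2 * γ) : ℝ) : ℂ) 0
    ((q ^ (-4 : ℤ) : ℝ) : ℂ) ((-(q ^ (-4 : ℤ) / x ^ 2) : ℝ) : ℂ)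

/-- The spectral parameter `ε = q^{2γ-2m}` of the non-Fock part of the spectrum. -/
noncomputable def eps (q γ : ℝ) (m : ℤ) : ℝ := q ^ (2 * γ - 2 * (m : ℝ))

/-- The non-Fock eigenfunction `k̃_m` at the lattice point `x = σ √c q^{-2k}`: on the positive half
`(-ε)^k ₂φ₁(-1/(εq²), -1/ε; 0; q^{-4}, -q^{-4}/x²)` with `ε = q^{2γ-2m}`, continued to the negative
half as an even function for odd `m` and as an odd function for even `m`. -/
noncomputable def kTilde (q γ : ℝ) (m : ℤ) (σ : ℤˣ) (k : ℤ) : ℂ :=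
  ((((σ ^ (m + 1) : ℤˣ) : ℤ) : ℝ) * (-eps q γ m) ^ k : ℝ) * kPhi q γ m (pt q γ σ k)

/-- The function `(-x)^{m-γ} √c^{γ-m} ₂φ₁(-q^{2m-2γ-2}, -q^{2m-2γ}; 0; q^{-4}, -q^{-4}/x²)` of real
`x ≠ 0`, with the principal value of the complex power `(-x)^{m-γ}`. -/
noncomputable def kPrincipal (q γ : ℝ) (m : ℤ) (x : ℝ) : ℂ :=
  ((-x : ℝ) : ℂ) ^ (((m : ℝ) - γ : ℝ) : ℂ) * ((√(cst q γ) ^ (γ - (m : ℝ)) : ℝ) : ℂ) * kPhi q γ m x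

/-- `M_c = (q^{-4}, q^{-4}, -c^{-1}q^{-2}, -cq^{-2}; q^{-4})_∞ / (-c, -c^{-1}q^{-4}; q^{-4})_∞`. -/
noncomputable def Mc (q γ : ℝ) : ℝ :=
  (qPochInf (q ^ (-4 : ℤ)) (q ^ (-4 : ℤ)) * qPochInf (q ^ (-4 : ℤ)) (q ^ (-4 : ℤ)) *
      qPochInf (-((cst q γ)⁻¹ * q ^ (-2 : ℤ))) (q ^ (-4 : ℤ)) *
      qPochInf (-(cst q γ * q ^ (-2 : ℤ))) (q ^ (-4 : ℤ))) /
    (qPochInf (-cst q γ) (q ^ (-4 : ℤ)) *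
      qPochInf (-((cst q γ)⁻¹ * q ^ (-4 : ℤ))) (q ^ (-4 : ℤ)))

/-- `2 M_c c^m q^{2m²} / (-c^{-1} q^{-2m-2}; q^{-2})_∞`, the squared norm of `k̃_m`. -/
noncomputable def normSq (q γ : ℝ) (m : ℤ) : ℝ :=
  2 * Mc q γ * (cst q γ ^ m * q ^ (2 * m ^ 2)) /
    qPochInf (-((cst q γ)⁻¹ * q ^ (-2 * m - 2))) (q ^ (-2 : ℤ))

end QOscillator

/-! Put r = q^{-2} and p = r². For real b ≠ 0 let F_b(k) = b^{-k} ₂φ₁(br, b; 0; p, -p^{1-k}/c)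
(`latticeFun`). On each half of the lattice k̃_m is, up to sign, F_b with b = -c r^{-m} = -1/ε_m
(`param`), and h̃_n is a multiple of F_b with b = r^{-n}. Everything thus concerns one family of
functions with a free parameter b.

F_b satisfies a second-order recurrence in k in which b enters only through 1/b
(`latticeFun_recurrence`). Hence a discrete Wronskian telescopes, and (1/b' - 1/b) ∑ F_b F_{b'} w is
a boundary term. It vanishes at k → -∞. At k → ∞, that is x → 0, the relation F_b(k) - F_b(k+1) =
(b-1) r^{k+1} F_{br}(k+1) expresses it through the limits L(b) of F_b (`hasSum_latticeFun_mul`).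

To find L(b), consider the entire function Γ_b(z) = (z;p)_∞ ₂φ₁(br, b; 0; p, z). Its Taylor
coefficients are ρ_n r^{n(n-1)} (-b)^n with a convergent sequence ρ_n (`coeff_gammaSeries`). This
yields the analytic continuation, and after a shift of the summation index it compares Γ_b at the
lattice points with a theta series. The result is that L(b) is a constant times (br;p)_∞ θ(-br²/c).

For b = -c r^{-m} the theta argument is r^{2-m}, a zero when m is even. For b = r^{-n} the factor
(br;p)_∞ vanishes when n is odd. So the boundary term is zero whenever the product of the two
functions is even in x; when it is odd, the two halves of the lattice cancel. The norms are the
limits b' → b, where the boundary term has a simple theta zero. Principal powers change the products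
only by the sign (-1)^{m+n}. -/

namespace QOscillator

open Filter Topology PowerSeries

/-! ### Evaluation of power series at points of absolute convergence -/

section Eval

variable {𝕜 : Type*} [NormedField 𝕜]

/-- Absolute convergence of a power series at a point. -/
def AbsConv (X : PowerSeries 𝕜) (z : 𝕜) : Prop := Summable fun n => ‖coeff n X * z ^ n‖

/-- The sum of a power series at a point. -/
noncomputable def pev (X : PowerSeries 𝕜) (z : 𝕜) : 𝕜 := ∑' n, coeff n X * z ^ n

theorem coeff_mul_mul_pow (X Y : PowerSeries 𝕜) (z : 𝕜) (n : ℕ) :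
    coeff n (X * Y) * z ^ n =
      ∑ kl ∈ Finset.HasAntidiagonal.antidiagonal n, coeff kl.1 X * z ^ kl.1 * (coeff kl.2 Y * z ^ kl.2) := by
  rw [coeff_mul, Finset.sum_mul]
  refine Finset.sum_congr rfl fun kl h => ?_
  rw [← Finset.HasAntidiagonal.mem_antidiagonal.mp h, pow_add]
  ring

theorem AbsConv.mul {X Y : PowerSeries 𝕜} {z : 𝕜} (hX : AbsConv X z) (hY : AbsConv Y z) :
    AbsConv (X * Y) z := by
  have := summable_norm_sum_mul_antidiagonal_of_summable_norm hX hY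
  simpa only [AbsConv, coeff_mul_mul_pow] using this

theorem AbsConv.sub {X Y : PowerSeries 𝕜} {z : 𝕜} (hX : AbsConv X z) (hY : AbsConv Y z) :
    AbsConv (X - Y) z := by
  refine Summable.of_nonneg_of_le (fun _ => norm_nonneg _) (fun n => ?_) (Summable.add hX hY)
  rw [map_sub, sub_mul]
  exact norm_sub_le _ _

theorem hasSum_C (a z : 𝕜) : HasSum (fun n => coeff n (C a) * z ^ n) a := by
  have := hasSum_single (f := fun n => coeff n (C a) * z ^ n) 0
    (fun n hn => by simp [coeff_C, hn])
  simpa using this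

theorem absConv_C (a z : 𝕜) : AbsConv (C a) z :=
  summable_of_ne_finset_zero (s := {0}) fun n hn => by
    simp [coeff_C, Finset.mem_singleton.not.mp hn]

theorem absConv_X (z : 𝕜) : AbsConv (X : PowerSeries 𝕜) z :=
  summable_of_ne_finset_zero (s := {1}) fun n hn => by
    simp [coeff_X, Finset.mem_singleton.not.mp hn]

@[simp] theorem pev_C (a z : 𝕜) : pev (C a) z = a := (hasSum_C a z).tsum_eq

@[simp] theorem pev_X (z : 𝕜) : pev (X : PowerSeries 𝕜) z = z := by
  have := hasSum_single (f := fun n => coeff n (X : PowerSeries 𝕜) * z ^ n) 1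
    (fun n hn => by simp [coeff_X, hn])
  simpa [pev] using this.tsum_eq

theorem absConv_one (z : 𝕜) : AbsConv (1 : PowerSeries 𝕜) z := by
  simpa using absConv_C (1 : 𝕜) z

@[simp] theorem pev_one (z : 𝕜) : pev (1 : PowerSeries 𝕜) z = 1 := by
  simpa using pev_C (1 : 𝕜) z

@[simp] theorem pev_zero_right (X : PowerSeries 𝕜) : pev X 0 = coeff 0 X := by
  have := hasSum_single (f := fun n => coeff n X * (0 : 𝕜) ^ n) 0 (fun n hn => by simp [hn])
  simpa [pev] using this.tsum_eq

theorem absConv_rescale {X : PowerSeries 𝕜} {a z : 𝕜} :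
    AbsConv (rescale a X) z ↔ AbsConv X (a * z) := by
  unfold AbsConv
  refine summable_congr fun n => ?_
  rw [coeff_rescale, mul_pow]
  ring_nf

theorem pev_rescale (X : PowerSeries 𝕜) (a z : 𝕜) : pev (rescale a X) z = pev X (a * z) := by
  unfold pev
  refine tsum_congr fun n => ?_
  rw [coeff_rescale, mul_pow]
  ring

variable [CompleteSpace 𝕜]

theorem AbsConv.hasSum {X : PowerSeries 𝕜} {z : 𝕜} (h : AbsConv X z) :
    HasSum (fun n => coeff n X * z ^ n) (pev X z) := (Summable.of_norm h).hasSum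

theorem pev_mul {X Y : PowerSeries 𝕜} {z : 𝕜} (hX : AbsConv X z) (hY : AbsConv Y z) :
    pev (X * Y) z = pev X z * pev Y z := by
  unfold pev
  rw [tsum_mul_tsum_eq_tsum_sum_antidiagonal_of_summable_norm hX hY]
  simp only [coeff_mul_mul_pow]

theorem pev_add {X Y : PowerSeries 𝕜} {z : 𝕜} (hX : AbsConv X z) (hY : AbsConv Y z) :
    pev (X + Y) z = pev X z + pev Y z := by
  refine HasSum.tsum_eq ?_
  simpa [add_mul] using hX.hasSum.add hY.hasSum

theorem pev_sub {X Y : PowerSeries 𝕜} {z : 𝕜} (hX : AbsConv X z) (hY : AbsConv Y z) :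
    pev (X - Y) z = pev X z - pev Y z := by
  refine HasSum.tsum_eq ?_
  simpa [sub_mul] using hX.hasSum.sub hY.hasSum

/-- Values of a power series along a null sequence inside a disc of absolute convergence. -/
theorem tendsto_pev_zero {X : PowerSeries 𝕜} {z : 𝕜} (h : AbsConv X z) {u : ℕ → 𝕜}
    (hu : Tendsto u atTop (𝓝 0)) (hz : ∀ n, ‖u n‖ ≤ ‖z‖) :
    Tendsto (fun n => pev X (u n)) atTop (𝓝 (coeff 0 X)) := by
  rw [← pev_zero_right X]
  refine tendsto_tsum_of_dominated_convergence h (fun k => (hu.pow k).const_mul _) ?_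
  filter_upwards with n k
  rw [norm_mul, norm_mul, norm_pow, norm_pow]
  gcongr
  exact hz n

end Eval

/-! ### Infinite `q`-shifted factorials -/

section Pochhammer

variable {𝕜 : Type*} [NormedField 𝕜]

@[simp] theorem qPoch_zero_right (a p : 𝕜) : qPoch a p 0 = 1 := by simp [qPoch]

@[simp] theorem qPoch_zero_left (p : 𝕜) (n : ℕ) : qPoch 0 p n = 1 := by simp [qPoch]

theorem qPoch_succ (a p : 𝕜) (n : ℕ) : qPoch a p (n + 1) = qPoch a p n * (1 - a * p ^ n) :=
  Finset.prod_range_succ _ _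

theorem qPoch_succ' (a p : 𝕜) (n : ℕ) : qPoch a p (n + 1) = (1 - a) * qPoch (a * p) p n := by
  unfold qPoch
  rw [Finset.prod_range_succ', mul_comm]
  congr 1
  · simp
  · exact Finset.prod_congr rfl fun i _ => by ring

theorem qPoch_add (a p : 𝕜) (m n : ℕ) :
    qPoch a p (m + n) = qPoch a p m * qPoch (a * p ^ m) p n := by
  unfold qPoch
  rw [Finset.prod_range_add]
  congr 1
  exact Finset.prod_congr rfl fun i _ => by ring

theorem pow_ne_one_of_norm_lt_one {p : 𝕜} (hp : ‖p‖ < 1) (n : ℕ) : p ^ (n + 1) ≠ 1 := fun h => by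
  have : ‖p ^ (n + 1)‖ < 1 := by
    rw [norm_pow]; exact pow_lt_one₀ (norm_nonneg _) hp (Nat.succ_ne_zero n)
  simp [h] at this

theorem qPoch_self_ne_zero {p : 𝕜} (hp : ‖p‖ < 1) (n : ℕ) : qPoch p p n ≠ 0 := by
  refine Finset.prod_ne_zero_iff.mpr fun i _ => ?_
  rw [← pow_succ']
  exact sub_ne_zero.mpr (pow_ne_one_of_norm_lt_one hp i).symm

theorem tendsto_pow_mul_zero {p : 𝕜} (hp : ‖p‖ < 1) (z : 𝕜) :
    Tendsto (fun n : ℕ => p ^ n * z) atTop (𝓝 0) := by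
  simpa using (tendsto_pow_atTop_nhds_zero_of_norm_lt_one hp).mul_const z

theorem norm_pow_mul_le {p : 𝕜} (hp : ‖p‖ < 1) (z : 𝕜) (n : ℕ) : ‖p ^ n * z‖ ≤ ‖z‖ := by
  rw [norm_mul, norm_pow]
  exact mul_le_of_le_one_left (norm_nonneg _) (pow_le_one₀ (norm_nonneg _) hp.le)

variable [CompleteSpace 𝕜]

theorem multipliable_qPoch {p : 𝕜} (hp : ‖p‖ < 1) (a : 𝕜) :
    Multipliable fun i : ℕ => 1 - a * p ^ i := by
  have h : Summable fun i : ℕ => ‖-(a * p ^ i)‖ := by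
    simp only [norm_neg, norm_mul, norm_pow]
    exact (summable_geometric_of_lt_one (norm_nonneg _) hp).mul_left _
  simpa [sub_eq_add_neg] using multipliable_one_add_of_summable h

theorem tendsto_qPoch {p : 𝕜} (hp : ‖p‖ < 1) (a : 𝕜) :
    Tendsto (qPoch a p) atTop (𝓝 (qPochInf a p)) :=
  (multipliable_qPoch hp a).hasProd.tendsto_prod_nat

theorem qPochInf_eq {p : 𝕜} (hp : ‖p‖ < 1) (a : 𝕜) (n : ℕ) :
    qPochInf a p = qPoch a p n * qPochInf (a * p ^ n) p := by
  refine tendsto_nhds_unique ((tendsto_add_atTop_iff_nat n).mpr (tendsto_qPoch hp a)) ?_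
  refine ((tendsto_qPoch hp (a * p ^ n)).const_mul (qPoch a p n)).congr fun k => ?_
  rw [add_comm k n, qPoch_add]

theorem qPochInf_step {p : 𝕜} (hp : ‖p‖ < 1) (a : 𝕜) :
    qPochInf a p = (1 - a) * qPochInf (a * p) p := by
  simpa [qPoch] using qPochInf_eq hp a 1

/-- A power series with `F(z) = (1 - z) F(pz)` is a multiple of `(z;p)_∞`. -/
theorem pev_eq_qPochInf_mul {p : 𝕜} (hp : ‖p‖ < 1) {F : PowerSeries 𝕜}
    (hF : F = (1 - X) * rescale p F) (h : ∀ z, AbsConv F z) (z : 𝕜) :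
    pev F z = qPochInf z p * coeff 0 F := by
  have step : ∀ w, pev F w = (1 - w) * pev F (p * w) := fun w => by
    conv_lhs => rw [hF]
    rw [pev_mul ((absConv_one w).sub (absConv_X w)) (absConv_rescale.mpr (h _)),
      pev_sub (absConv_one w) (absConv_X w), pev_rescale, pev_one, pev_X]
  have iter : ∀ n : ℕ, qPoch z p n * pev F (p ^ n * z) = pev F z := fun n => by
    induction n with
    | zero => simp
    | succ n ih =>
      rw [← ih, step (p ^ n * z), qPoch_succ, pow_succ']
      ring_nf
  have lim := (tendsto_qPoch hp z).mul
    (tendsto_pev_zero (h z) (tendsto_pow_mul_zero hp z) (norm_pow_mul_le hp z))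
  exact tendsto_nhds_unique (tendsto_const_nhds.congr fun n => (iter n).symm) lim

/-- A power series with `(1 - z) F(z) = F(pz)` is inverse to `(z;p)_∞` up to a constant. -/
theorem qPochInf_mul_pev_eq {p : 𝕜} (hp : ‖p‖ < 1) {F : PowerSeries 𝕜}
    (hF : (1 - X) * F = rescale p F) {z : 𝕜} (h : ∀ n : ℕ, AbsConv F (p ^ n * z)) :
    qPochInf z p * pev F z = coeff 0 F := by
  have h0 : AbsConv F z := by simpa using h 0
  have step : ∀ n : ℕ, (1 - p ^ n * z) * pev F (p ^ n * z) = pev F (p ^ (n + 1) * z) := fun n => by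
    have : pev ((1 - X) * F) (p ^ n * z) = pev (rescale p F) (p ^ n * z) := by rw [hF]
    rw [pev_mul ((absConv_one _).sub (absConv_X _)) (h n),
      pev_sub (absConv_one _) (absConv_X _), pev_rescale, pev_one, pev_X] at this
    rw [this, pow_succ', mul_assoc]
  have iter : ∀ n : ℕ, qPoch z p n * pev F z = pev F (p ^ n * z) := fun n => by
    induction n with
    | zero => simp
    | succ n ih =>
      rw [← step n, ← ih, qPoch_succ]
      ring
  refine tendsto_nhds_unique ((tendsto_qPoch hp z).mul_const _) ?_
  simp only [iter]
  exact tendsto_pev_zero h0 (tendsto_pow_mul_zero hp z) (norm_pow_mul_le hp z)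

end Pochhammer

/-! ### Power series, their q-difference equations and the coefficients of Γ_b -/

section Series

variable {𝕜 : Type*} [NormedField 𝕜]

theorem absConv_of_ratio {F : PowerSeries 𝕜} {c : ℕ → 𝕜} {l z : 𝕜}
    (hF : ∀ n, coeff (n + 1) F = c n * coeff n F) (hc : Tendsto c atTop (𝓝 l))
    (hl : ‖l * z‖ < 1) : AbsConv F z := by
  obtain ⟨ρ, h1, h2⟩ := exists_between hl
  refine summable_of_ratio_norm_eventually_le (r := ρ) h2 ?_
  have h3 : ∀ᶠ n in atTop, ‖c n * z‖ < ρ :=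
    ((hc.mul_const z).norm).eventually_lt_const h1
  filter_upwards [h3] with n hn
  rw [norm_norm, norm_norm, hF, pow_succ]
  calc ‖c n * coeff n F * (z ^ n * z)‖ = ‖c n * z‖ * ‖coeff n F * z ^ n‖ := by
        rw [← norm_mul]; ring_nf
    _ ≤ _ := by gcongr

/-- The series `∑ (-1)^i p^{i(i-1)/2} z^i / (p;p)_i` with `p = r²`. -/
noncomputable def eulerSeries (r : 𝕜) : PowerSeries 𝕜 :=
  mk fun i => (-1) ^ i * r ^ (i * (i - 1)) / qPoch (r ^ 2) (r ^ 2) i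

/-- The series `∑ (a;p)_n z^n / (p;p)_n` of the `q`-binomial theorem. -/
noncomputable def binomialSeries (a p : 𝕜) : PowerSeries 𝕜 :=
  mk fun n => qPoch a p n / qPoch p p n

/-- The series `∑ (a;p)_n (b;p)_n z^n / (p;p)_n`. -/
noncomputable def phiSeries (a b p : 𝕜) : PowerSeries 𝕜 :=
  mk fun n => qPoch a p n * qPoch b p n / qPoch p p n

/-- The coefficients `∑_{n+i=s} (br;p)_n r^i / ((p;p)_n (p;p)_i)`, `p = r²`, as a power series. -/
noncomputable def rhoSeries (r b : 𝕜) : PowerSeries 𝕜 :=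
  binomialSeries (b * r) (r ^ 2) * rescale r (binomialSeries 0 (r ^ 2))

/-- The power series of the entire function `(z;p)_∞ ₂φ₁(br,b;0;p,z)`, `p = r²`. -/
noncomputable def gammaSeries (r b : 𝕜) : PowerSeries 𝕜 :=
  eulerSeries r * phiSeries (b * r) b (r ^ 2)

/-- The truncated subtraction in the exponent i(i-1) is harmless: at i = 0 the other factor
vanishes. -/
theorem succ_mul_pred (i : ℕ) : (i + 1) * (i + 1 - 1) = i * (i - 1) + 2 * i := by
  cases i with
  | zero => rfl
  | succ n => simp only [Nat.add_sub_cancel]; ring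

theorem norm_sq_lt_one {r : 𝕜} (hr : ‖r‖ < 1) : ‖r ^ 2‖ < 1 := by
  rw [norm_pow]; exact pow_lt_one₀ (norm_nonneg _) hr two_ne_zero

theorem one_sub_pow_succ_ne_zero {p : 𝕜} (hp : ‖p‖ < 1) (n : ℕ) : 1 - p * p ^ n ≠ 0 := by
  rw [← pow_succ']
  exact sub_ne_zero.mpr (pow_ne_one_of_norm_lt_one hp n).symm

theorem tendsto_one_sub_mul_pow {p : 𝕜} (hp : ‖p‖ < 1) (a : 𝕜) :
    Tendsto (fun n : ℕ => 1 - a * p ^ n) atTop (𝓝 1) := by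
  simpa using ((tendsto_pow_atTop_nhds_zero_of_norm_lt_one hp).const_mul a).const_sub 1

theorem coeff_succ_eulerSeries {r : 𝕜} (hr : ‖r‖ < 1) (i : ℕ) :
    coeff (i + 1) (eulerSeries r) =
      -(r ^ 2) ^ i / (1 - r ^ 2 * (r ^ 2) ^ i) * coeff i (eulerSeries r) := by
  have h1 := one_sub_pow_succ_ne_zero (norm_sq_lt_one hr) i
  have h2 := qPoch_self_ne_zero (norm_sq_lt_one hr) i
  simp only [eulerSeries, coeff_mk]
  rw [succ_mul_pred, qPoch_succ]
  field_simp
  ring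

theorem coeff_succ_binomialSeries {p : 𝕜} (hp : ‖p‖ < 1) (a : 𝕜) (i : ℕ) :
    coeff (i + 1) (binomialSeries a p) =
      (1 - a * p ^ i) / (1 - p * p ^ i) * coeff i (binomialSeries a p) := by
  have h1 := one_sub_pow_succ_ne_zero hp i
  have h2 := qPoch_self_ne_zero hp i
  simp only [binomialSeries, coeff_mk]
  rw [qPoch_succ, qPoch_succ]
  field_simp

theorem coeff_succ_phiSeries {p : 𝕜} (hp : ‖p‖ < 1) (a b : 𝕜) (i : ℕ) :
    coeff (i + 1) (phiSeries a b p) =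
      (1 - a * p ^ i) * (1 - b * p ^ i) / (1 - p * p ^ i) * coeff i (phiSeries a b p) := by
  have h1 := one_sub_pow_succ_ne_zero hp i
  have h2 := qPoch_self_ne_zero hp i
  simp only [phiSeries, coeff_mk]
  rw [qPoch_succ, qPoch_succ, qPoch_succ]
  field_simp

theorem absConv_eulerSeries {r : 𝕜} (hr : ‖r‖ < 1) (z : 𝕜) : AbsConv (eulerSeries r) z := by
  have hp := norm_sq_lt_one hr
  refine absConv_of_ratio (l := 0) (coeff_succ_eulerSeries hr) ?_ (by simp)
  have := (tendsto_pow_atTop_nhds_zero_of_norm_lt_one hp).neg.div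
    (tendsto_one_sub_mul_pow hp (r ^ 2)) one_ne_zero
  simpa [Pi.div_def] using this

theorem absConv_binomialSeries {p : 𝕜} (hp : ‖p‖ < 1) (a : 𝕜) {z : 𝕜} (hz : ‖z‖ < 1) :
    AbsConv (binomialSeries a p) z := by
  refine absConv_of_ratio (l := 1) (coeff_succ_binomialSeries hp a) ?_ (by simpa using hz)
  have := (tendsto_one_sub_mul_pow hp a).div (tendsto_one_sub_mul_pow hp p) one_ne_zero
  simpa [Pi.div_def] using this

theorem absConv_phiSeries {p : 𝕜} (hp : ‖p‖ < 1) (a b : 𝕜) {z : 𝕜} (hz : ‖z‖ < 1) :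
    AbsConv (phiSeries a b p) z := by
  refine absConv_of_ratio (l := 1) (coeff_succ_phiSeries hp a b) ?_ (by simpa using hz)
  have := ((tendsto_one_sub_mul_pow hp a).mul (tendsto_one_sub_mul_pow hp b)).div
    (tendsto_one_sub_mul_pow hp p) one_ne_zero
  simpa [Pi.div_def] using this

@[simp] theorem constantCoeff_rescale_apply (a : 𝕜) (F : PowerSeries 𝕜) :
    constantCoeff (rescale a F) = constantCoeff F := by
  rw [← coeff_zero_eq_constantCoeff_apply, coeff_rescale]
  simp

theorem coeff_one_X_mul (F : PowerSeries 𝕜) : coeff 1 (X * F) = coeff 0 F := coeff_succ_X_mul 0 F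

/-- This and the next two q-difference equations are coefficient ratios with denominators cleared:
rescaling by p multiplies the n-th coefficient by p^n, and `X` shifts the index. -/
theorem eulerSeries_eq {r : 𝕜} (hr : ‖r‖ < 1) :
    eulerSeries r = (1 - X) * rescale (r ^ 2) (eulerSeries r) := by
  ext n
  cases n with
  | zero => simp [sub_mul]
  | succ n =>
    have h1 := one_sub_pow_succ_ne_zero (norm_sq_lt_one hr) n
    rw [sub_mul, map_sub, one_mul, coeff_succ_X_mul, coeff_rescale, coeff_rescale,
      coeff_succ_eulerSeries hr]
    field_simp
    ring

theorem binomialSeries_eq {p : 𝕜} (hp : ‖p‖ < 1) (a : 𝕜) :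
    (1 - X) * binomialSeries a p = (1 - C a * X) * rescale p (binomialSeries a p) := by
  ext n
  cases n with
  | zero => simp [sub_mul, mul_assoc]
  | succ n =>
    have h1 := one_sub_pow_succ_ne_zero hp n
    rw [sub_mul, sub_mul, map_sub, map_sub, one_mul, one_mul, mul_assoc, coeff_C_mul,
      coeff_succ_X_mul, coeff_succ_X_mul, coeff_rescale, coeff_rescale,
      coeff_succ_binomialSeries hp, pow_succ']
    linear_combination coeff n (binomialSeries a p) * div_mul_cancel₀ (1 - a * p ^ n) h1

theorem phiSeries_eq {p : 𝕜} (hp : ‖p‖ < 1) (a b : 𝕜) :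
    (1 - X) * phiSeries a b p = (1 - C (a + b) * X) * rescale p (phiSeries a b p) +
      C (a * b) * X * rescale p (rescale p (phiSeries a b p)) := by
  ext n
  cases n with
  | zero => simp [sub_mul, mul_assoc]
  | succ n =>
    have h1 := one_sub_pow_succ_ne_zero hp n
    rw [map_add, sub_mul, sub_mul, map_sub, map_sub, one_mul, one_mul, mul_assoc, mul_assoc,
      coeff_C_mul, coeff_C_mul, coeff_succ_X_mul, coeff_succ_X_mul, coeff_succ_X_mul,
      coeff_rescale, coeff_rescale, coeff_rescale, coeff_rescale, coeff_succ_phiSeries hp,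
      pow_succ']
    linear_combination coeff n (phiSeries a b p) *
      div_mul_cancel₀ ((1 - a * p ^ n) * (1 - b * p ^ n)) h1

/-- Since (b;p)_n (1 - bp^n) = (1-b) (bp;p)_n, the parameter pair (br, b) becomes (br, br²). This is
again a pair of the same form, with br in place of b. -/
theorem phiSeries_shift {r : 𝕜} (b : 𝕜) :
    C b * rescale (r ^ 2) (phiSeries (b * r) b (r ^ 2)) - phiSeries (b * r) b (r ^ 2) =
      -(C (1 - b) * phiSeries (b * r * r) (b * r) (r ^ 2)) := by
  ext n
  have h : qPoch b (r ^ 2) n * (1 - b * (r ^ 2) ^ n) = (1 - b) * qPoch (b * r ^ 2) (r ^ 2) n := by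
    rw [← qPoch_succ, qPoch_succ']
  have h' : b * r * r = b * r ^ 2 := by ring
  rw [map_sub, map_neg, coeff_C_mul, coeff_C_mul, coeff_rescale, h']
  simp only [phiSeries, coeff_mk]
  linear_combination (-qPoch (b * r) (r ^ 2) n / qPoch (r ^ 2) (r ^ 2) n) * h

/-- The equation of `phiSeries` multiplied by E(z) = (z;p)_∞. The factor 1 - z is absorbed by E(z) =
(1-z) E(pz), and a second use of this at pz produces 1 - pz. -/
theorem gammaSeries_eq {r : 𝕜} (hr : ‖r‖ < 1) (b : 𝕜) :
    gammaSeries r b = (1 - C (b * r + b) * X) * rescale (r ^ 2) (gammaSeries r b) +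
      C (b * r * b) * X * (1 - C (r ^ 2) * X) *
        rescale (r ^ 2) (rescale (r ^ 2) (gammaSeries r b)) := by
  have h1 := eulerSeries_eq hr
  have h2 := phiSeries_eq (norm_sq_lt_one hr) (b * r) b
  have h3 : rescale (r ^ 2) (eulerSeries r) =
      (1 - C (r ^ 2) * X) * rescale (r ^ 2) (rescale (r ^ 2) (eulerSeries r)) := by
    have := congrArg (rescale (r ^ 2)) h1
    rwa [map_mul, map_sub, map_one, rescale_X] at this
  simp only [gammaSeries, map_mul] at h2 h3 ⊢
  linear_combination (phiSeries (b * r) b (r ^ 2)) * h1 + rescale (r ^ 2) (eulerSeries r) * h2 +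
    C b * C r * C b * X * rescale (r ^ 2) (rescale (r ^ 2) (phiSeries (b * r) b (r ^ 2))) * h3

theorem gammaSeries_shift {r : 𝕜} (hr : ‖r‖ < 1) (b : 𝕜) :
    C b * (1 - X) * rescale (r ^ 2) (gammaSeries r b) - gammaSeries r b =
      -(C (1 - b) * gammaSeries r (b * r)) := by
  have h1 := eulerSeries_eq hr
  have h2 := phiSeries_shift (r := r) b
  simp only [gammaSeries, map_mul]
  linear_combination (-C b * rescale (r ^ 2) (phiSeries (b * r) b (r ^ 2))) * h1 +
    eulerSeries r * h2

/-- By the q-binomial theorem `rhoSeries` represents (brz;p)_∞ / ((z;p)_∞ (rz;p)_∞); passing from z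
to pz removes one factor from each product. -/
theorem rhoSeries_eq {r : 𝕜} (hr : ‖r‖ < 1) (b : 𝕜) :
    (1 - X) * (1 - C r * X) * rhoSeries r b =
      (1 - C (b * r) * X) * rescale (r ^ 2) (rhoSeries r b) := by
  have hp := norm_sq_lt_one hr
  have h1 := binomialSeries_eq hp (b * r)
  have h2 : (1 - C r * X) * rescale r (binomialSeries 0 (r ^ 2)) =
      rescale (r ^ 2) (rescale r (binomialSeries 0 (r ^ 2))) := by
    have := congrArg (rescale r) (binomialSeries_eq hp (0 : 𝕜))
    rw [map_mul, map_sub, map_one, rescale_X] at this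
    simpa [rescale_rescale, mul_comm] using this
  simp only [rhoSeries, map_mul] at h1 ⊢
  linear_combination (1 - C r * X) * rescale r (binomialSeries 0 (r ^ 2)) * h1 +
    (1 - C b * C r * X) * rescale (r ^ 2) (binomialSeries (b * r) (r ^ 2)) * h2

theorem coeff_zero_gammaSeries (r b : 𝕜) : coeff 0 (gammaSeries r b) = 1 := by
  simp [gammaSeries, eulerSeries, phiSeries]

theorem coeff_zero_rhoSeries (r b : 𝕜) : coeff 0 (rhoSeries r b) = 1 := by
  rw [rhoSeries, coeff_zero_eq_constantCoeff_apply, map_mul, constantCoeff_rescale_apply]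
  simp [binomialSeries]

theorem coeff_one_rhoSeries {r : 𝕜} (hr : ‖r‖ < 1) (b : 𝕜) :
    (1 - r ^ 2) * coeff 1 (rhoSeries r b) = 1 + r - b * r := by
  have h := congrArg (coeff 1) (rhoSeries_eq hr b)
  have e1 : (1 - X) * (1 - C r * X) * rhoSeries r b =
      rhoSeries r b - X * (C (1 + r) * rhoSeries r b - X * (C r * rhoSeries r b)) := by
    simp only [map_add, map_one]; ring
  rw [e1, sub_mul, one_mul, mul_assoc, map_sub, map_sub, coeff_C_mul, coeff_one_X_mul,
    coeff_one_X_mul, coeff_rescale, map_sub, coeff_zero_X_mul, coeff_C_mul, coeff_rescale,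
    coeff_zero_rhoSeries] at h
  linear_combination h

theorem coeff_add_two_rhoSeries {r : 𝕜} (hr : ‖r‖ < 1) (b : 𝕜) (n : ℕ) :
    (1 - (r ^ 2) ^ (n + 2)) * coeff (n + 2) (rhoSeries r b) =
      (1 + r - b * r * (r ^ 2) ^ (n + 1)) * coeff (n + 1) (rhoSeries r b) -
        r * coeff n (rhoSeries r b) := by
  have h := congrArg (coeff (n + 2)) (rhoSeries_eq hr b)
  have e1 : (1 - X) * (1 - C r * X) * rhoSeries r b =
      rhoSeries r b - X * (C (1 + r) * rhoSeries r b - X * (C r * rhoSeries r b)) := by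
    simp only [map_add, map_one]; ring
  rw [e1, sub_mul, one_mul, mul_assoc, map_sub, map_sub, coeff_C_mul, coeff_succ_X_mul,
    coeff_succ_X_mul, coeff_rescale, map_sub, coeff_succ_X_mul, coeff_C_mul, coeff_C_mul,
    coeff_rescale] at h
  linear_combination h

theorem coeff_one_gammaSeries {r : 𝕜} (hr : ‖r‖ < 1) (b : 𝕜) :
    (1 - r ^ 2) * coeff 1 (gammaSeries r b) = -(b * r + b) + b * r * b := by
  have h := congrArg (coeff 1) (gammaSeries_eq hr b)
  have e1 : (1 - C (b * r + b) * X) * rescale (r ^ 2) (gammaSeries r b) +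
      C (b * r * b) * X * (1 - C (r ^ 2) * X) *
        rescale (r ^ 2) (rescale (r ^ 2) (gammaSeries r b)) =
      rescale (r ^ 2) (gammaSeries r b) - X * (C (b * r + b) * rescale (r ^ 2) (gammaSeries r b) -
        C (b * r * b) * rescale (r ^ 2) (rescale (r ^ 2) (gammaSeries r b)) +
        X * (C (b * r * b * r ^ 2) * rescale (r ^ 2) (rescale (r ^ 2) (gammaSeries r b)))) := by
    simp only [map_mul, map_pow]; ring
  rw [e1, map_sub, coeff_one_X_mul, map_add, map_sub, coeff_zero_X_mul] at h
  simp only [coeff_C_mul, coeff_rescale, coeff_zero_gammaSeries] at h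
  linear_combination h

theorem coeff_add_two_gammaSeries {r : 𝕜} (hr : ‖r‖ < 1) (b : 𝕜) (n : ℕ) :
    (1 - (r ^ 2) ^ (n + 2)) * coeff (n + 2) (gammaSeries r b) =
      (-(b * r + b) * (r ^ 2) ^ (n + 1) + b * r * b * ((r ^ 2) ^ (n + 1)) ^ 2) *
        coeff (n + 1) (gammaSeries r b) -
        b * r * b * r ^ 2 * ((r ^ 2) ^ n) ^ 2 * coeff n (gammaSeries r b) := by
  have h := congrArg (coeff (n + 2)) (gammaSeries_eq hr b)
  have e1 : (1 - C (b * r + b) * X) * rescale (r ^ 2) (gammaSeries r b) +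
      C (b * r * b) * X * (1 - C (r ^ 2) * X) *
        rescale (r ^ 2) (rescale (r ^ 2) (gammaSeries r b)) =
      rescale (r ^ 2) (gammaSeries r b) - X * (C (b * r + b) * rescale (r ^ 2) (gammaSeries r b) -
        C (b * r * b) * rescale (r ^ 2) (rescale (r ^ 2) (gammaSeries r b)) +
        X * (C (b * r * b * r ^ 2) * rescale (r ^ 2) (rescale (r ^ 2) (gammaSeries r b)))) := by
    simp only [map_mul, map_pow]; ring
  rw [e1, map_sub, coeff_succ_X_mul, map_add, map_sub, coeff_succ_X_mul] at h
  simp only [coeff_C_mul, coeff_rescale] at h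
  linear_combination h

/-- The q-difference equations give both sides the same three-term recurrence and the same first two
values. The factor r^{n(n-1)} is what makes `gammaSeries` converge everywhere, while `phiSeries` is
only controlled for ‖z‖ < 1. -/
theorem coeff_gammaSeries {r : 𝕜} (hr : ‖r‖ < 1) (b : 𝕜) (n : ℕ) :
    coeff n (gammaSeries r b) = coeff n (rhoSeries r b) * r ^ (n * (n - 1)) * (-b) ^ n := by
  have key : ∀ n, coeff n (gammaSeries r b) =
        coeff n (rhoSeries r b) * r ^ (n * (n - 1)) * (-b) ^ n ∧
      coeff (n + 1) (gammaSeries r b) =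
        coeff (n + 1) (rhoSeries r b) * r ^ ((n + 1) * (n + 1 - 1)) * (-b) ^ (n + 1) := by
    intro n
    induction n with
    | zero =>
      have h0 : (1 : 𝕜) - r ^ 2 ≠ 0 := by
        simpa using one_sub_pow_succ_ne_zero (norm_sq_lt_one hr) 0
      refine ⟨by simp [coeff_zero_gammaSeries, coeff_zero_rhoSeries], mul_left_cancel₀ h0 ?_⟩
      rw [zero_add, coeff_one_gammaSeries hr]
      linear_combination b * coeff_one_rhoSeries hr b
    | succ n ih =>
      refine ⟨ih.2, ?_⟩
      have h0 : (1 : 𝕜) - (r ^ 2) ^ (n + 2) ≠ 0 := by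
        rw [pow_succ']
        exact one_sub_pow_succ_ne_zero (norm_sq_lt_one hr) (n + 1)
      refine mul_left_cancel₀ h0 ?_
      have h1 := coeff_add_two_gammaSeries hr b n
      have h2 := coeff_add_two_rhoSeries hr b n
      rw [ih.1, ih.2, succ_mul_pred] at h1
      rw [succ_mul_pred, succ_mul_pred, add_assoc n 1 1, h1]
      linear_combination (-(r ^ (n * (n - 1) + 2 * n + 2 * (n + 1)) * (-b) ^ (n + 1 + 1))) * h2
  exact (key n).1

end Series

/-! ### Bounds uniform in the parameter and global convergence of Γ_b -/

section Bounds

theorem exists_norm_le_of_tendsto {E : Type*} [SeminormedAddCommGroup E] {u : ℕ → E} {l : E}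
    (h : Tendsto u atTop (𝓝 l)) : ∃ M, 0 ≤ M ∧ ∀ n, ‖u n‖ ≤ M := by
  obtain ⟨M, hM⟩ := h.norm.bddAbove_range
  exact ⟨M, (norm_nonneg _).trans (hM ⟨0, rfl⟩), fun n => hM ⟨n, rfl⟩⟩

variable {𝕜 : Type*} [NormedField 𝕜]

theorem norm_qPoch_le (a p : 𝕜) (n : ℕ) : ‖qPoch a p n‖ ≤ qPoch (-‖a‖) ‖p‖ n := by
  unfold qPoch
  rw [norm_prod]
  refine Finset.prod_le_prod (fun _ _ => norm_nonneg _) fun i _ => ?_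
  calc ‖1 - a * p ^ i‖ ≤ ‖(1 : 𝕜)‖ + ‖a * p ^ i‖ := norm_sub_le _ _
    _ = 1 - -‖a‖ * ‖p‖ ^ i := by rw [norm_one, norm_mul, norm_pow]; ring

theorem qPoch_neg_le_qPoch_neg {x y p : ℝ} (hx : 0 ≤ x) (hxy : x ≤ y) (hp : 0 ≤ p) (n : ℕ) :
    qPoch (-x) p n ≤ qPoch (-y) p n := by
  refine Finset.prod_le_prod (fun i _ => ?_) fun i _ => ?_
  · have := mul_nonneg hx (pow_nonneg hp i)
    linarith
  · have := mul_le_mul_of_nonneg_right hxy (pow_nonneg hp i)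
    linarith

/-- Uniformly in a, ‖(a;p)_n‖ ≤ (-‖a‖;‖p‖)_n ≤ (-β;‖p‖)_n, and the last sequence converges. -/
theorem exists_norm_qPoch_le {p : 𝕜} (hp : ‖p‖ < 1) (β : ℝ) :
    ∃ M, 0 ≤ M ∧ ∀ a : 𝕜, ‖a‖ ≤ β → ∀ n, ‖qPoch a p n‖ ≤ M := by
  have hp' : ‖‖p‖‖ < 1 := by simpa using hp
  obtain ⟨M, h0, hM⟩ := exists_norm_le_of_tendsto (tendsto_qPoch hp' (-β))
  exact ⟨M, h0, fun a ha n => (norm_qPoch_le a p n).trans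
    ((qPoch_neg_le_qPoch_neg (norm_nonneg a) ha (norm_nonneg p) n).trans
      ((le_abs_self _).trans (hM n)))⟩

theorem summable_pow_mul_pred_mul_pow {ρ : ℝ} (h0 : 0 ≤ ρ) (h1 : ρ < 1) (x : ℝ) :
    Summable fun n : ℕ => ρ ^ (n * (n - 1)) * |x| ^ n := by
  have hρ : ‖ρ ^ 2‖ < 1 := norm_sq_lt_one (by rwa [Real.norm_of_nonneg h0])
  have h : AbsConv (mk fun n => ρ ^ (n * (n - 1)) : PowerSeries ℝ) |x| := by
    refine absConv_of_ratio (c := fun n => (ρ ^ 2) ^ n) (l := 0) (fun n => ?_)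
      (tendsto_pow_atTop_nhds_zero_of_norm_lt_one hρ) (by simp)
    simp only [coeff_mk]
    rw [succ_mul_pred]
    ring
  refine Summable.congr h fun n => ?_
  rw [coeff_mk, Real.norm_of_nonneg (by positivity)]

theorem coeff_rhoSeries (r b : 𝕜) (n : ℕ) :
    coeff n (rhoSeries r b) = ∑ i ∈ Finset.range (n + 1),
      coeff i (binomialSeries 0 (r ^ 2)) * r ^ i *
        coeff (n - i) (binomialSeries (b * r) (r ^ 2)) := by
  rw [rhoSeries, mul_comm, coeff_mul]
  rw [Finset.Nat.sum_antidiagonal_eq_sum_range_succ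
    (fun i j => coeff i (rescale r (binomialSeries 0 (r ^ 2))) *
      coeff j (binomialSeries (b * r) (r ^ 2)))]
  refine Finset.sum_congr rfl fun i _ => ?_
  rw [coeff_rescale, mul_comm (r ^ i)]

theorem norm_coeff_gammaSeries_mul_pow {r : 𝕜} (hr : ‖r‖ < 1) (b z : 𝕜) (n : ℕ) :
    ‖coeff n (gammaSeries r b) * z ^ n‖ =
      ‖coeff n (rhoSeries r b)‖ * (‖r‖ ^ (n * (n - 1)) * |‖b‖ * ‖z‖| ^ n) := by
  rw [coeff_gammaSeries hr, abs_of_nonneg (by positivity)]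
  simp only [norm_mul, norm_pow, norm_neg]
  ring

variable [CompleteSpace 𝕜]

theorem qPochInf_mul_binomialSeries {p : 𝕜} (hp : ‖p‖ < 1) {z : 𝕜} (hz : ‖z‖ < 1) :
    qPochInf z p * pev (binomialSeries 0 p) z = 1 := by
  rw [qPochInf_mul_pev_eq hp]
  · simp [binomialSeries]
  · simpa using binomialSeries_eq hp (0 : 𝕜)
  · exact fun n => absConv_binomialSeries hp 0 ((norm_pow_mul_le hp z n).trans_lt hz)

theorem qPochInf_ne_zero_of_norm_lt_one {p : 𝕜} (hp : ‖p‖ < 1) {z : 𝕜} (hz : ‖z‖ < 1) :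
    qPochInf z p ≠ 0 := left_ne_zero_of_mul_eq_one (qPochInf_mul_binomialSeries hp hz)

/-- Splitting off finitely many nonzero factors moves the argument into the unit disc, where a power
series gives the inverse. -/
theorem qPochInf_ne_zero {p : 𝕜} (hp : ‖p‖ < 1) {z : 𝕜} (hz : ∀ n : ℕ, z * p ^ n ≠ 1) :
    qPochInf z p ≠ 0 := by
  obtain ⟨n, hn⟩ := (((tendsto_pow_mul_zero hp z).norm).eventually_lt_const
    (by simp : ‖(0 : 𝕜)‖ < 1)).exists
  rw [qPochInf_eq hp z n]
  refine mul_ne_zero (Finset.prod_ne_zero_iff.mpr fun i _ => sub_ne_zero.mpr (hz i).symm)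
    (qPochInf_ne_zero_of_norm_lt_one hp ?_)
  rwa [mul_comm]

theorem pev_eulerSeries {r : 𝕜} (hr : ‖r‖ < 1) (z : 𝕜) :
    pev (eulerSeries r) z = qPochInf z (r ^ 2) := by
  rw [pev_eq_qPochInf_mul (norm_sq_lt_one hr) (eulerSeries_eq hr) (absConv_eulerSeries hr)]
  simp [eulerSeries]

theorem exists_norm_inv_qPoch_self_le {p : 𝕜} (hp : ‖p‖ < 1) :
    ∃ M, 0 ≤ M ∧ ∀ n, ‖(qPoch p p n)⁻¹‖ ≤ M :=
  exists_norm_le_of_tendsto ((tendsto_qPoch hp p).inv₀ (qPochInf_ne_zero_of_norm_lt_one hp hp))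

theorem exists_norm_coeff_binomialSeries_le {p : 𝕜} (hp : ‖p‖ < 1) (β : ℝ) :
    ∃ M, 0 ≤ M ∧ ∀ a : 𝕜, ‖a‖ ≤ β → ∀ n, ‖coeff n (binomialSeries a p)‖ ≤ M := by
  obtain ⟨M, h0, hM⟩ := exists_norm_qPoch_le hp β
  obtain ⟨N, h0', hN⟩ := exists_norm_inv_qPoch_self_le hp
  refine ⟨M * N, mul_nonneg h0 h0', fun a ha n => ?_⟩
  rw [binomialSeries, coeff_mk, div_eq_mul_inv, norm_mul]
  exact mul_le_mul (hM a ha n) (hN n) (norm_nonneg _) h0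

/-- ρ_n is the convolution of a summable sequence with a bounded one. Uniformity in b is needed
later to let b' tend to b inside sums. -/
theorem exists_norm_coeff_rhoSeries_le {r : 𝕜} (hr : ‖r‖ < 1) (β : ℝ) :
    ∃ M, 0 ≤ M ∧ ∀ b : 𝕜, ‖b‖ ≤ β → ∀ n, ‖coeff n (rhoSeries r b)‖ ≤ M := by
  have hp := norm_sq_lt_one hr
  obtain ⟨M, h0, hM⟩ := exists_norm_coeff_binomialSeries_le hp β
  have hs := absConv_binomialSeries hp 0 hr
  have hs0 : 0 ≤ ∑' i, ‖coeff i (binomialSeries 0 (r ^ 2)) * r ^ i‖ :=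
    tsum_nonneg fun _ => norm_nonneg _
  refine ⟨(∑' i, ‖coeff i (binomialSeries 0 (r ^ 2)) * r ^ i‖) * M, mul_nonneg hs0 h0,
    fun b hb n => ?_⟩
  have hb' : ‖b * r‖ ≤ β := by
    rw [norm_mul]
    exact (mul_le_of_le_one_right (norm_nonneg b) hr.le).trans hb
  rw [coeff_rhoSeries]
  calc _ ≤ ∑ i ∈ Finset.range (n + 1), ‖coeff i (binomialSeries 0 (r ^ 2)) * r ^ i‖ * M := by
        refine norm_sum_le_of_le _ fun i _ => ?_
        rw [norm_mul]
        gcongr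
        exact hM _ hb' _
    _ ≤ _ := by
        rw [← Finset.sum_mul]
        gcongr
        exact hs.sum_le_tsum _ fun _ _ => norm_nonneg _

theorem absConv_gammaSeries {r : 𝕜} (hr : ‖r‖ < 1) (b z : 𝕜) : AbsConv (gammaSeries r b) z := by
  obtain ⟨M, h0, hM⟩ := exists_norm_coeff_rhoSeries_le hr ‖b‖
  refine Summable.of_nonneg_of_le (fun _ => norm_nonneg _) (fun n => ?_)
    ((summable_pow_mul_pred_mul_pow (norm_nonneg r) hr (‖b‖ * ‖z‖)).mul_left M)
  rw [norm_coeff_gammaSeries_mul_pow hr]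
  gcongr
  exact hM b le_rfl n

theorem pev_gammaSeries_eq {r : 𝕜} (hr : ‖r‖ < 1) (b : 𝕜) {z : 𝕜} (hz : ‖z‖ < 1) :
    pev (gammaSeries r b) z =
      qPochInf z (r ^ 2) * pev (phiSeries (b * r) b (r ^ 2)) z := by
  rw [gammaSeries, pev_mul (absConv_eulerSeries hr z)
    (absConv_phiSeries (norm_sq_lt_one hr) _ _ hz), pev_eulerSeries hr]

end Bounds

/-! ### The analytic continuation of the basic hypergeometric series -/

section Continuation

theorem differentiable_pev {F : PowerSeries ℂ} (h : ∀ z, AbsConv F z) :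
    Differentiable ℂ (pev F) := fun z => by
  have hd : DifferentiableOn ℂ (fun w : ℂ => ∑' n, coeff n F * w ^ n) (Metric.ball 0 (‖z‖ + 1)) :=
    Complex.differentiableOn_tsum_of_summable_norm (h ((‖z‖ + 1 : ℝ) : ℂ))
      (fun n => (by fun_prop : Differentiable ℂ fun w : ℂ => coeff n F * w ^ n).differentiableOn)
      Metric.isOpen_ball fun n w hw => by
        have hw' : ‖w‖ < ‖z‖ + 1 := by simpa using hw
        rw [norm_mul, norm_mul, norm_pow, norm_pow, Complex.norm_real,
          Real.norm_of_nonneg (by positivity)]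
        gcongr
  exact hd.differentiableAt (Metric.isOpen_ball.mem_nhds (by simp))

theorem isPreconnected_cut : IsPreconnected {z : ℂ | 1 - z ∈ Complex.slitPlane} := by
  have h : {z : ℂ | 1 - z ∈ Complex.slitPlane} = (fun w : ℂ => 1 - w) '' Complex.slitPlane := by
    ext z
    constructor
    · exact fun hz => ⟨1 - z, hz, by simp⟩
    · rintro ⟨w, hw, rfl⟩
      simpa using hw
  rw [h]
  refine IsPreconnected.image ?_ _ (by fun_prop)
  exact (Complex.starConvex_one_slitPlane.isPathConnected Complex.one_mem_slitPlane).isConnected.isPreconnected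

theorem isOpen_cut : IsOpen {z : ℂ | 1 - z ∈ Complex.slitPlane} :=
  Complex.isOpen_slitPlane.preimage (by fun_prop : Continuous fun z : ℂ => 1 - z)

/-- The identity theorem on the connected slit domain; it makes `phi21` independent of the choice in
its definition. -/
theorem IsPhi21.eqOn {a b c q : ℂ} {F G : ℂ → ℂ} (hF : IsPhi21 a b c q F)
    (hG : IsPhi21 a b c q G) : Set.EqOn F G {z : ℂ | 1 - z ∈ Complex.slitPlane} := by
  refine AnalyticOnNhd.eqOn_of_preconnected_of_eventuallyEq (𝕜 := ℂ) (z₀ := 0)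
    (hF.1.analyticOnNhd isOpen_cut) (hG.1.analyticOnNhd isOpen_cut) isPreconnected_cut
    (by simp) ?_
  filter_upwards [Metric.ball_mem_nhds (0 : ℂ) one_pos] with z hz
  have hz' : ‖z‖ < 1 := by simpa using hz
  exact (hF.2 z hz').unique (hG.2 z hz')

/-- Numerator and denominator are entire, and the zeros p^{-n} of the denominator all lie on the cut
[1,∞). -/
theorem isPhi21_gammaSeries {r : ℝ} (h0 : 0 < r) (h1 : r < 1) (b : ℂ) :
    IsPhi21 (b * r) b 0 ((r : ℂ) ^ 2)
      fun z => pev (gammaSeries (r : ℂ) b) z / qPochInf z ((r : ℂ) ^ 2) := by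
  have hr : ‖(r : ℂ)‖ < 1 := by rwa [Complex.norm_real, Real.norm_of_nonneg h0.le]
  have hp := norm_sq_lt_one hr
  have hE : (fun z => qPochInf z ((r : ℂ) ^ 2)) = pev (eulerSeries (r : ℂ)) :=
    funext fun z => (pev_eulerSeries hr z).symm
  refine ⟨?_, fun z hz => ?_⟩
  · refine DifferentiableOn.div (differentiable_pev (absConv_gammaSeries hr b)).differentiableOn
      ?_ fun z hz => ?_
    · rw [hE]
      exact (differentiable_pev (absConv_eulerSeries hr)).differentiableOn
    · refine qPochInf_ne_zero hp fun n hn => ?_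
      have hpos : 0 < (r ^ 2) ^ n := by positivity
      have hz' : z = (((r ^ 2) ^ n)⁻¹ : ℝ) := by
        push_cast
        exact eq_inv_of_mul_eq_one_left hn
      have hle : 1 ≤ ((r ^ 2) ^ n)⁻¹ :=
        (one_le_inv₀ hpos).mpr (pow_le_one₀ (by positivity) (pow_le_one₀ h0.le h1.le))
      rw [Set.mem_ofPred_eq, hz', Complex.mem_slitPlane_iff] at hz
      simp only [Complex.sub_re, Complex.one_re, Complex.ofReal_re, Complex.sub_im,
        Complex.one_im, Complex.ofReal_im] at hz
      rcases hz with hz | hz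
      · linarith
      · simp at hz
  · have hs := (absConv_phiSeries hp (b * r) b hz).hasSum
    simp only [pev_gammaSeries_eq hr b hz]
    rw [mul_div_cancel_left₀ _ (qPochInf_ne_zero_of_norm_lt_one hp hz)]
    simpa [phiSeries] using hs

theorem phi21_eq {r : ℝ} (h0 : 0 < r) (h1 : r < 1) (b : ℂ) {z : ℂ}
    (hz : 1 - z ∈ Complex.slitPlane) :
    phi21 (b * r) b 0 ((r : ℂ) ^ 2) z =
      pev (gammaSeries (r : ℂ) b) z / qPochInf z ((r : ℂ) ^ 2) := by
  have hF := isPhi21_gammaSeries h0 h1 b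
  have h : ∃ F, IsPhi21 (b * r) b 0 ((r : ℂ) ^ 2) F := ⟨_, hF⟩
  rw [phi21, dif_pos h]
  exact h.choose_spec.eqOn hF hz

theorem ofReal_qPoch (a p : ℝ) (n : ℕ) : ((qPoch a p n : ℝ) : ℂ) = qPoch (a : ℂ) (p : ℂ) n := by
  simp [qPoch]

theorem ofReal_qPochInf {p : ℝ} (hp : ‖p‖ < 1) (a : ℝ) :
    ((qPochInf a p : ℝ) : ℂ) = qPochInf (a : ℂ) (p : ℂ) := by
  have hp' : ‖(p : ℂ)‖ < 1 := by rwa [Complex.norm_real]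
  refine tendsto_nhds_unique ((Complex.continuous_ofReal.tendsto _).comp (tendsto_qPoch hp a))
    ((tendsto_qPoch hp' (a : ℂ)).congr fun n => ?_)
  exact (ofReal_qPoch a p n).symm

theorem ofReal_coeff_gammaSeries (r b : ℝ) (n : ℕ) :
    ((coeff n (gammaSeries r b) : ℝ) : ℂ) = coeff n (gammaSeries (r : ℂ) (b : ℂ)) := by
  simp only [gammaSeries, coeff_mul, eulerSeries, phiSeries, coeff_mk]
  push_cast [ofReal_qPoch]
  rfl

theorem ofReal_pev_gammaSeries (r b z : ℝ) :
    ((pev (gammaSeries r b) z : ℝ) : ℂ) = pev (gammaSeries (r : ℂ) (b : ℂ)) z := by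
  unfold pev
  rw [Complex.ofReal_tsum]
  refine tsum_congr fun n => ?_
  push_cast [ofReal_coeff_gammaSeries]
  rfl

theorem phi21_ofReal {r : ℝ} (h0 : 0 < r) (h1 : r < 1) (b : ℝ) {z : ℝ} (hz : z < 1) :
    phi21 ((b * r : ℝ) : ℂ) (b : ℂ) 0 ((r ^ 2 : ℝ) : ℂ) (z : ℂ) =
      ((pev (gammaSeries r b) z / qPochInf z (r ^ 2) : ℝ) : ℂ) := by
  have hr : ‖r‖ < 1 := by rwa [Real.norm_of_nonneg h0.le]
  have hz' : (1 : ℂ) - z ∈ Complex.slitPlane := by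
    rw [← Complex.ofReal_one, ← Complex.ofReal_sub, Complex.ofReal_mem_slitPlane]
    linarith
  have := phi21_eq h0 h1 (b : ℂ) hz'
  rw [Complex.ofReal_div, ofReal_pev_gammaSeries, ofReal_qPochInf (norm_sq_lt_one hr)]
  push_cast
  exact this

end Continuation

/-! ### The eigenfunctions on the lattice -/

section Lattice

/-- The point `-p^{1-k}/c`, `p = r²`, at which the hypergeometric function is evaluated. -/
noncomputable def node (r c : ℝ) (k : ℤ) : ℝ := -(r ^ (2 * (1 - k)) / c)

/-- The sequence `b^{-k} ₂φ₁(br, b; 0; r², -r^{2-2k}/c)`. -/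
noncomputable def latticeFun (r c b : ℝ) (k : ℤ) : ℝ :=
  b ^ (-k) * (pev (gammaSeries r b) (node r c k) / qPochInf (node r c k) (r ^ 2))

/-- The bilateral theta series `∑_j p^{j(j-1)/2} t^j`, `p = r²`. -/
noncomputable def thetaSum (r t : ℝ) : ℝ := ∑' j : ℤ, r ^ (j * (j - 1)) * t ^ j

variable {r : ℝ}

theorem norm_lt_one_of_pos (h0 : 0 < r) (h1 : r < 1) : ‖r‖ < 1 := by
  rwa [Real.norm_of_nonneg h0.le]

theorem node_succ (h0 : 0 < r) (c : ℝ) (k : ℤ) : r ^ 2 * node r c (k + 1) = node r c k := by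
  have : r ^ (2 * (1 - k)) = r ^ 2 * r ^ (2 * (1 - (k + 1))) := by
    rw [← zpow_natCast, ← zpow_add₀ h0.ne']
    congr 1
    push_cast
    ring
  rw [node, node, this]
  ring

theorem node_succ_eq {c : ℝ} (k : ℤ) :
    node r c (k + 1) = -(c * r ^ (2 * k))⁻¹ := by
  rw [node, show 2 * (1 - (k + 1)) = -(2 * k) by ring, zpow_neg, mul_inv, div_eq_mul_inv, mul_comm]

theorem node_neg (h0 : 0 < r) {c : ℝ} (hc : 0 < c) (k : ℤ) : node r c k < 0 :=
  neg_neg_of_pos (div_pos (zpow_pos h0 _) hc)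

theorem qPochInf_node_succ (h0 : 0 < r) (h1 : r < 1) (c : ℝ) (k : ℤ) :
    qPochInf (node r c (k + 1)) (r ^ 2) =
      (1 - node r c (k + 1)) * qPochInf (node r c k) (r ^ 2) := by
  rw [qPochInf_step (norm_sq_lt_one (norm_lt_one_of_pos h0 h1)), ← node_succ h0 c k,
    mul_comm (r ^ 2)]

theorem one_le_qPoch {x p : ℝ} (hx : 0 ≤ x) (hp : 0 ≤ p) (n : ℕ) : 1 ≤ qPoch (-x) p n := by
  have := qPoch_neg_le_qPoch_neg le_rfl hx hp n
  simpa using this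

theorem one_le_qPochInf {x p : ℝ} (hx : 0 ≤ x) (hp : 0 ≤ p) (hp1 : p < 1) :
    1 ≤ qPochInf (-x) p :=
  ge_of_tendsto' (tendsto_qPoch (by rwa [Real.norm_of_nonneg hp]) (-x)) (one_le_qPoch hx hp)

theorem one_le_qPochInf_node (h0 : 0 < r) (h1 : r < 1) {c : ℝ} (hc : 0 < c) (k : ℤ) :
    1 ≤ qPochInf (node r c k) (r ^ 2) :=
  one_le_qPochInf (div_pos (zpow_pos h0 _) hc).le (by positivity) (by nlinarith)

/-- This is `gammaSeries_shift` at z = `node r c (k + 1)`, where pz is the node of k. It makes the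
size r^{k+1} of the difference of neighbouring values explicit. -/
theorem latticeFun_sub_succ (h0 : 0 < r) (h1 : r < 1) {c : ℝ} (hc : 0 < c) {b : ℝ} (hb : b ≠ 0)
    (k : ℤ) : latticeFun r c b k - latticeFun r c b (k + 1) =
      (b - 1) * r ^ (k + 1) * latticeFun r c (b * r) (k + 1) := by
  have hr := norm_lt_one_of_pos h0 h1
  have hz := node_neg h0 hc (k + 1)
  have hQ := one_le_qPochInf_node h0 h1 hc k
  have hstep := qPochInf_node_succ h0 h1 c k
  have hΓ : pev (C b * (1 - X) * rescale (r ^ 2) (gammaSeries r b)) (node r c (k + 1)) -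
      pev (gammaSeries r b) (node r c (k + 1)) =
      -((1 - b) * pev (gammaSeries r (b * r)) (node r c (k + 1))) := by
    rw [← pev_sub, gammaSeries_shift hr]
    · have : -(C (1 - b) * gammaSeries r (b * r)) = C (-(1 - b)) * gammaSeries r (b * r) := by
        rw [map_neg, neg_mul]
      rw [this, pev_mul (absConv_C _ _) (absConv_gammaSeries hr _ _), pev_C, neg_mul]
    · exact ((absConv_C _ _).mul ((absConv_one _).sub (absConv_X _))).mul
        (absConv_rescale.mpr (absConv_gammaSeries hr _ _))
    · exact absConv_gammaSeries hr _ _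
  rw [pev_mul ((absConv_C _ _).mul ((absConv_one _).sub (absConv_X _)))
      (absConv_rescale.mpr (absConv_gammaSeries hr _ _)),
    pev_mul (absConv_C _ _) ((absConv_one _).sub (absConv_X _)),
    pev_sub (absConv_one _) (absConv_X _), pev_C, pev_one, pev_X, pev_rescale,
    node_succ h0] at hΓ
  have h2 : r ^ (k + 1) * (b * r) ^ (-(k + 1)) = b ^ (-(k + 1)) := by
    rw [mul_zpow, mul_left_comm, ← zpow_add₀ h0.ne']
    simp
  have h3 : b ^ (-k) = b ^ (-(k + 1)) * b := by
    rw [← zpow_add_one₀ hb]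
    congr 1
    ring
  have hz1 : 1 - node r c (k + 1) ≠ 0 := by linarith
  have hQ0 : qPochInf (node r c k) (r ^ 2) ≠ 0 := by linarith
  simp only [latticeFun]
  rw [hstep, h3]
  have e : (b - 1) * r ^ (k + 1) * ((b * r) ^ (-(k + 1)) *
      (pev (gammaSeries r (b * r)) (node r c (k + 1)) /
        ((1 - node r c (k + 1)) * qPochInf (node r c k) (r ^ 2)))) =
      b ^ (-(k + 1)) * ((b - 1) * pev (gammaSeries r (b * r)) (node r c (k + 1))) /
        ((1 - node r c (k + 1)) * qPochInf (node r c k) (r ^ 2)) := by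
    rw [← h2]; ring
  rw [e]
  field_simp
  linear_combination hΓ

/-- This is `gammaSeries_eq` at the node of k + 1: then pz and p²z are the nodes of k and k - 1. As
b occurs only in 1/b, this is an eigenvalue equation with spectral parameter 1/b. -/
theorem latticeFun_recurrence (h0 : 0 < r) (h1 : r < 1) {c : ℝ} (hc : 0 < c) {b : ℝ} (hb : b ≠ 0)
    (k : ℤ) : (1 + r + c * r ^ (2 * k) / b) * latticeFun r c b k =
      r * latticeFun r c b (k - 1) + (1 + c * r ^ (2 * k)) * latticeFun r c b (k + 1) := by
  have hr := norm_lt_one_of_pos h0 h1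
  have hz := node_neg h0 hc (k + 1)
  have hw := node_neg h0 hc k
  have hQ := one_le_qPochInf_node h0 h1 hc (k - 1)
  have hstep := qPochInf_node_succ h0 h1 c k
  have hstep' := qPochInf_node_succ h0 h1 c (k - 1)
  have hn := node_succ h0 c k
  have hn' := node_succ h0 c (k - 1)
  rw [sub_add_cancel] at hstep' hn'
  have hΓ := congrArg (pev · (node r c (k + 1))) (gammaSeries_eq hr b)
  have a1 := absConv_gammaSeries hr b
  have a2 : ∀ z, AbsConv (1 - C (b * r + b) * X : PowerSeries ℝ) z := fun z =>
    (absConv_one _).sub ((absConv_C _ _).mul (absConv_X _))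
  have a3 : ∀ z, AbsConv (C (b * r * b) * X : PowerSeries ℝ) z := fun z =>
    (absConv_C _ _).mul (absConv_X _)
  have a4 : ∀ z, AbsConv (1 - C (r ^ 2) * X : PowerSeries ℝ) z := fun z =>
    (absConv_one _).sub ((absConv_C _ _).mul (absConv_X _))
  have a5 : ∀ z, AbsConv (rescale (r ^ 2) (gammaSeries r b)) z := fun z =>
    absConv_rescale.mpr (a1 _)
  have a6 : ∀ z, AbsConv (rescale (r ^ 2) (rescale (r ^ 2) (gammaSeries r b))) z := fun z =>
    absConv_rescale.mpr (a5 _)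
  rw [pev_add ((a2 _).mul (a5 _)) (((a3 _).mul (a4 _)).mul (a6 _)), pev_mul (a2 _) (a5 _),
    pev_mul ((a3 _).mul (a4 _)) (a6 _), pev_mul (a3 _) (a4 _),
    pev_sub (absConv_one _) ((absConv_C _ _).mul (absConv_X _)),
    pev_sub (absConv_one _) ((absConv_C _ _).mul (absConv_X _)),
    pev_mul (absConv_C _ _) (absConv_X _), pev_mul (absConv_C _ _) (absConv_X _),
    pev_mul (absConv_C _ _) (absConv_X _), pev_rescale, pev_rescale, pev_rescale, hn, hn'] at hΓ
  simp only [pev_C, pev_one, pev_X, hn] at hΓ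
  have hc' : c * r ^ (2 * k) = -(node r c (k + 1))⁻¹ := by
    rw [node_succ_eq, inv_neg, inv_inv, neg_neg]
  have hk : b ^ (-k) = b ^ (-(k + 1)) * b := by
    rw [← zpow_add_one₀ hb]
    congr 1
    ring
  have hk' : b ^ (-(k - 1)) = b ^ (-(k + 1)) * b * b := by
    rw [← zpow_add_one₀ hb, ← zpow_add_one₀ hb]
    congr 1
    ring
  simp only [latticeFun]
  rw [hstep, hstep', hc', hk, hk']
  rw [← hn] at hw hΓ ⊢
  have hz1 : 1 - node r c (k + 1) ≠ 0 := by linarith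
  have hw1 : 1 - r ^ 2 * node r c (k + 1) ≠ 0 := by linarith
  have hQ0 : qPochInf (node r c (k - 1)) (r ^ 2) ≠ 0 := by linarith
  generalize node r c (k + 1) = z at *
  generalize qPochInf (node r c (k - 1)) (r ^ 2) = Q at *
  have hz0 : z ≠ 0 := hz.ne
  field_simp
  linear_combination (1 - z) * hΓ

end Lattice

/-! ### Behaviour of the eigenfunctions near the origin -/

section Asymptotics

variable {r : ℝ}

theorem zpow_mul_pred (x : ℝ) (n : ℕ) : x ^ ((n : ℤ) * ((n : ℤ) - 1)) = x ^ (n * (n - 1)) := by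
  rw [← zpow_natCast]
  congr 1
  cases n with
  | zero => simp
  | succ n => push_cast; simp

theorem summable_theta (h0 : 0 < r) (h1 : r < 1) {t : ℝ} (ht : 0 ≤ t) :
    Summable fun j : ℤ => r ^ (j * (j - 1)) * t ^ j := by
  refine Summable.of_nat_of_neg ?_ ?_
  · refine (summable_pow_mul_pred_mul_pow h0.le h1 t).congr fun n => ?_
    rw [zpow_mul_pred, zpow_natCast, abs_of_nonneg ht]
  · refine (summable_pow_mul_pred_mul_pow h0.le h1 (r ^ 2 * t⁻¹)).congr fun n => ?_
    rw [abs_of_nonneg (by positivity), zpow_neg, zpow_natCast, mul_pow, ← mul_assoc, ← pow_mul,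
      ← pow_add, ← zpow_natCast r, inv_pow]
    congr 2
    cases n with
    | zero => simp
    | succ n => push_cast; simp; ring

/-- The coefficients of `rhoSeries`, extended by zero to negative indices. -/
noncomputable def rhoInt (r b : ℝ) (j : ℤ) : ℝ :=
  if 0 ≤ j then coeff j.toNat (rhoSeries r b) else 0

/-- Completing the square: with j = s - k one has s(s-1) - 2ks + k(k+1) = j(j-1). -/
theorem scaled_term (h0 : 0 < r) {c t : ℝ} (ht : t ≠ 0) {b : ℝ} (h : t = b * (r ^ 2 / c))
    (k s : ℕ) :
    t ^ (-(k : ℤ)) * r ^ (k * (k + 1)) * (r ^ (s * (s - 1)) * (-b * node r c k) ^ s) =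
      r ^ (((s : ℤ) - k) * ((s : ℤ) - k - 1)) * t ^ ((s : ℤ) - k) := by
  have e1 : -b * node r c k = r ^ (-2 * (k : ℤ)) * t := by
    rw [node, h, show 2 * (1 - (k : ℤ)) = -2 * (k : ℤ) + (2 : ℕ) by push_cast; ring,
      zpow_add₀ h0.ne', zpow_natCast]
    ring
  have e2 : r ^ (k * (k + 1)) = r ^ ((k : ℤ) * (k + 1)) := by
    rw [← zpow_natCast]; push_cast; rfl
  rw [e1, mul_pow, ← zpow_mul_pred, e2, ← zpow_natCast t, ← zpow_natCast (r ^ _), ← zpow_mul,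
    zpow_sub₀ ht, div_eq_mul_inv, ← zpow_neg]
  have e3 : r ^ (((s : ℤ) - k) * ((s : ℤ) - k - 1)) =
      r ^ ((k : ℤ) * (k + 1)) * r ^ ((s : ℤ) * (s - 1)) * r ^ (-2 * (k : ℤ) * s) := by
    rw [← zpow_add₀ h0.ne', ← zpow_add₀ h0.ne']
    congr 1
    ring
  rw [e3]
  ring

/-- The substitution j = s - k turns the power series into a bilateral sum, the terms with j < -k
being zero by definition of `rhoInt`. Only the ρ-factor now depends on k. -/
theorem scaled_pev_gammaSeries (h0 : 0 < r) (h1 : r < 1) {c t : ℝ} (ht : t ≠ 0) {b : ℝ}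
    (h : t = b * (r ^ 2 / c)) (k : ℕ) :
    t ^ (-(k : ℤ)) * r ^ (k * (k + 1)) * pev (gammaSeries r b) (node r c k) =
      ∑' j : ℤ, rhoInt r b (j + k) * (r ^ (j * (j - 1)) * t ^ j) := by
  have hinj : Function.Injective fun s : ℕ => (s : ℤ) - k := fun a b hab => by
    simpa using hab
  rw [pev, ← tsum_mul_left, ← hinj.tsum_eq]
  · refine tsum_congr fun s => ?_
    rw [← scaled_term h0 ht h k s, coeff_gammaSeries (norm_lt_one_of_pos h0 h1), rhoInt,
      if_pos (by simp)]
    simp only [sub_add_cancel, Int.toNat_natCast]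
    rw [mul_pow]
    ring
  · intro j hj
    by_contra hcon
    refine hj ?_
    have : ¬ 0 ≤ j + k := fun hle => hcon ⟨(j + k).toNat, by simp [Int.toNat_of_nonneg hle]⟩
    simp [rhoInt, this]

theorem exists_abs_rhoInt_le (h0 : 0 < r) (h1 : r < 1) (β : ℝ) :
    ∃ M, 0 ≤ M ∧ ∀ b : ℝ, |b| ≤ β → ∀ j, |rhoInt r b j| ≤ M := by
  obtain ⟨M, hM0, hM⟩ := exists_norm_coeff_rhoSeries_le (norm_lt_one_of_pos h0 h1) β
  refine ⟨M, hM0, fun b hb j => ?_⟩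
  rw [rhoInt]
  split_ifs
  · exact hM b hb _
  · simpa using hM0

theorem tendsto_coeff_binomialSeries {p : ℝ} (hp : ‖p‖ < 1) (a : ℝ) :
    Tendsto (fun n => coeff n (binomialSeries a p)) atTop (𝓝 (qPochInf a p / qPochInf p p)) := by
  simp only [binomialSeries, coeff_mk]
  exact (tendsto_qPoch hp a).div (tendsto_qPoch hp p) (qPochInf_ne_zero_of_norm_lt_one hp hp)

/-- A summable sequence convolved with a convergent one tends to the sum of the first times the
limit of the second; here the sum is 1/(r;p)_∞. -/
theorem tendsto_coeff_rhoSeries (h0 : 0 < r) (h1 : r < 1) (b : ℝ) :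
    Tendsto (fun n => coeff n (rhoSeries r b)) atTop
      (𝓝 (qPochInf (b * r) (r ^ 2) / (qPochInf (r ^ 2) (r ^ 2) * qPochInf r (r ^ 2)))) := by
  have hr := norm_lt_one_of_pos h0 h1
  have hp := norm_sq_lt_one hr
  obtain ⟨M, hM0, hM⟩ := exists_norm_coeff_binomialSeries_le hp |b * r|
  have hlim := tendsto_coeff_binomialSeries hp (b * r)
  have hval : pev (binomialSeries 0 (r ^ 2)) r * (qPochInf (b * r) (r ^ 2) /
      qPochInf (r ^ 2) (r ^ 2)) =
      qPochInf (b * r) (r ^ 2) / (qPochInf (r ^ 2) (r ^ 2) * qPochInf r (r ^ 2)) := by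
    rw [eq_div_of_mul_eq (qPochInf_ne_zero_of_norm_lt_one hp hr)
      ((mul_comm _ _).trans (qPochInf_mul_binomialSeries hp hr))]
    field_simp
  rw [← hval, pev, ← tsum_mul_right]
  have hs : Summable fun i => ‖coeff i (binomialSeries 0 (r ^ 2)) * r ^ i‖ * M :=
    Summable.mul_right M (absConv_binomialSeries hp 0 hr)
  refine (tendsto_tsum_of_dominated_convergence hs
    (f := fun n i => if i ∈ Finset.range (n + 1) then coeff i (binomialSeries 0 (r ^ 2)) * r ^ i *
      coeff (n - i) (binomialSeries (b * r) (r ^ 2)) else 0) (fun i => ?_) ?_).congr fun n => ?_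
  · have h2 : Tendsto (fun n => coeff i (binomialSeries 0 (r ^ 2)) * r ^ i *
        coeff (n - i) (binomialSeries (b * r) (r ^ 2))) atTop _ :=
      (hlim.comp (tendsto_sub_atTop_nat i)).const_mul _
    refine h2.congr' ?_
    filter_upwards [eventually_ge_atTop i] with n hn
    rw [if_pos (Finset.mem_range.mpr (by omega))]
  · refine Eventually.of_forall fun n i => ?_
    split_ifs
    · rw [norm_mul]
      gcongr
      exact hM _ le_rfl _
    · rw [norm_zero]
      positivity
  · rw [coeff_rhoSeries, tsum_eq_sum (s := Finset.range (n + 1)) fun i hi => if_neg hi]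
    exact Finset.sum_congr rfl fun i hi => if_pos hi

/-- Dominated convergence: ρ_{j+k} tends to its limit for each fixed j, and the theta series at |t|
is a majorant. -/
theorem tendsto_scaled_pev_gammaSeries (h0 : 0 < r) (h1 : r < 1) {c t : ℝ} (ht : t ≠ 0) {b : ℝ}
    (h : t = b * (r ^ 2 / c)) :
    Tendsto (fun k : ℕ => t ^ (-(k : ℤ)) * r ^ (k * (k + 1)) *
      pev (gammaSeries r b) (node r c k)) atTop
      (𝓝 (qPochInf (b * r) (r ^ 2) / (qPochInf (r ^ 2) (r ^ 2) * qPochInf r (r ^ 2)) *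
        thetaSum r t)) := by
  obtain ⟨M, hM0, hM⟩ := exists_abs_rhoInt_le h0 h1 |b|
  have hs : Summable fun j : ℤ => M * (r ^ (j * (j - 1)) * |t| ^ j) :=
    (summable_theta h0 h1 (abs_nonneg t)).mul_left M
  simp only [scaled_pev_gammaSeries h0 h1 ht h]
  rw [thetaSum, ← tsum_mul_left]
  refine tendsto_tsum_of_dominated_convergence hs (fun j => Tendsto.mul_const _ ?_) ?_
  · have hk : Tendsto (fun k : ℕ => (j + k).toNat) atTop atTop :=
      tendsto_atTop.mpr fun n => by
        filter_upwards [eventually_ge_atTop (n + j.natAbs)] with k hk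
        omega
    refine ((tendsto_coeff_rhoSeries h0 h1 b).comp hk).congr' ?_
    filter_upwards [eventually_ge_atTop j.natAbs] with k hk
    rw [rhoInt, if_pos (by omega)]
    rfl
  · refine Eventually.of_forall fun k j => ?_
    rw [norm_mul, norm_mul, norm_zpow, norm_zpow, Real.norm_of_nonneg h0.le,
      Real.norm_eq_abs t]
    gcongr
    exact hM b le_rfl _

/-- Each step in k brings in a factor 1 + 1/(cp^k), which the scaling turns into 1 + cp^k. The
scaled denominators therefore converge as well. -/
theorem qPochInf_node_natCast (h0 : 0 < r) (h1 : r < 1) {c : ℝ} (hc : c ≠ 0) (k : ℕ) :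
    (r ^ 2 / c) ^ (-(k : ℤ)) * r ^ (k * (k + 1)) * qPochInf (node r c k) (r ^ 2) =
      qPoch (-c) (r ^ 2) k * qPochInf (-(r ^ 2 / c)) (r ^ 2) := by
  have hy : r ^ 2 / c ≠ 0 := div_ne_zero (pow_ne_zero 2 h0.ne') hc
  induction k with
  | zero => simp [node]
  | succ k ih =>
    have e1 : r ^ ((k + 1) * (k + 1 + 1)) = r ^ (k * (k + 1)) * (r ^ 2 * (r ^ 2) ^ k) := by
      rw [← pow_succ', ← pow_mul, ← pow_add]
      congr 1
      ring
    have e2 : (r ^ 2 / c) ^ (-((k + 1 : ℕ) : ℤ)) = (r ^ 2 / c) ^ (-(k : ℤ)) * (r ^ 2 / c)⁻¹ := by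
      rw [← zpow_sub_one₀ hy]
      congr 1
      push_cast
      ring
    have e3 : node r c ((k : ℤ) + 1) = -(c * (r ^ 2) ^ k)⁻¹ := by
      rw [node_succ_eq, zpow_mul, zpow_natCast]
      norm_cast
    have e4 : (r ^ 2 / c)⁻¹ * (r ^ 2 * (r ^ 2) ^ k) * (1 - node r c ((k : ℤ) + 1)) =
        1 - -c * (r ^ 2) ^ k := by
      have : (r ^ 2) ^ k ≠ 0 := pow_ne_zero _ (pow_ne_zero 2 h0.ne')
      rw [e3]
      generalize (r ^ 2) ^ k = P at *
      field_simp
      ring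
    rw [e1, e2, Nat.cast_succ, qPochInf_node_succ h0 h1, qPoch_succ]
    linear_combination (1 - -c * (r ^ 2) ^ k) * ih + (r ^ 2 / c) ^ (-(k : ℤ)) * r ^ (k * (k + 1)) *
      qPochInf (node r c k) (r ^ 2) * e4

theorem gammaSeries_one (r : ℝ) : gammaSeries r 1 = eulerSeries r := by
  have : phiSeries (1 * r) 1 (r ^ 2) = 1 := by
    ext n
    cases n with
    | zero => simp [phiSeries]
    | succ n =>
      simp [phiSeries, qPoch_succ', coeff_one]
  rw [gammaSeries, this, mul_one]

/-- Jacobi's triple product identity. -/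
theorem thetaSum_eq (h0 : 0 < r) (h1 : r < 1) {t : ℝ} (ht : t ≠ 0) :
    thetaSum r t = qPochInf (r ^ 2) (r ^ 2) * (qPochInf (-t) (r ^ 2) *
      qPochInf (-(r ^ 2 / t)) (r ^ 2)) := by
  have hr := norm_lt_one_of_pos h0 h1
  have hp := norm_sq_lt_one hr
  have hc : r ^ 2 / t ≠ 0 := div_ne_zero (pow_ne_zero 2 h0.ne') ht
  have ht' : r ^ 2 / (r ^ 2 / t) = t := by field_simp
  -- For b = 1 the ₂φ₁ is identically 1, so the scaled values are explicit products; their limit is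
  -- compared with the theta series. The choice c = r²/t makes the theta argument t.
  have hlim := tendsto_scaled_pev_gammaSeries h0 h1 (c := r ^ 2 / t) (b := 1) ht (by rw [ht', one_mul])
  have key : ∀ k : ℕ, t ^ (-(k : ℤ)) * r ^ (k * (k + 1)) *
      pev (gammaSeries r 1) (node r (r ^ 2 / t) k) =
      qPoch (-(r ^ 2 / t)) (r ^ 2) k * qPochInf (-t) (r ^ 2) := fun k => by
    rw [gammaSeries_one, pev_eulerSeries hr]
    have := qPochInf_node_natCast h0 h1 hc k
    rwa [ht'] at this
  simp only [key] at hlim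
  have hu := tendsto_nhds_unique hlim ((tendsto_qPoch hp _).mul_const _)
  have hp0 := qPochInf_ne_zero_of_norm_lt_one hp hp
  have hr0 := qPochInf_ne_zero_of_norm_lt_one hp hr
  rw [one_mul] at hu
  field_simp at hu
  linear_combination hu

/-- The modified theta function `(x;r²)_∞ (r²/x;r²)_∞`. -/
noncomputable def thetaProd (r x : ℝ) : ℝ := qPochInf x (r ^ 2) * qPochInf (r ^ 2 / x) (r ^ 2)

/-- The limit of `latticeFun r c b k` for `k → ∞`. -/
noncomputable def latticeLim (r c b : ℝ) : ℝ :=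
  qPochInf (b * r) (r ^ 2) / qPochInf r (r ^ 2) *
    (thetaProd r (-(b * (r ^ 2 / c))) / thetaProd r (-c))

theorem latticeFun_natCast (h0 : 0 < r) (h1 : r < 1) {c : ℝ} (hc : 0 < c) {b : ℝ} (hb : b ≠ 0)
    (k : ℕ) : latticeFun r c b k =
      ((b * (r ^ 2 / c)) ^ (-(k : ℤ)) * r ^ (k * (k + 1)) * pev (gammaSeries r b) (node r c k)) /
        (qPoch (-c) (r ^ 2) k * qPochInf (-(r ^ 2 / c)) (r ^ 2)) := by
  have hy : r ^ 2 / c ≠ 0 := div_ne_zero (pow_ne_zero 2 h0.ne') hc.ne'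
  have h2 : (r ^ 2 / c) ^ (-(k : ℤ)) ≠ 0 := zpow_ne_zero _ hy
  have h3 : r ^ (k * (k + 1)) ≠ 0 := pow_ne_zero _ h0.ne'
  have h4 : qPochInf (node r c k) (r ^ 2) ≠ 0 := by
    have := one_le_qPochInf_node h0 h1 hc k
    linarith
  rw [← qPochInf_node_natCast h0 h1 hc.ne', mul_zpow, latticeFun]
  field_simp

theorem tendsto_latticeFun (h0 : 0 < r) (h1 : r < 1) {c : ℝ} (hc : 0 < c) {b : ℝ} (hb : b ≠ 0) :
    Tendsto (fun k : ℕ => latticeFun r c b k) atTop (𝓝 (latticeLim r c b)) := by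
  have hr := norm_lt_one_of_pos h0 h1
  have hp := norm_sq_lt_one hr
  have hy : r ^ 2 / c ≠ 0 := div_ne_zero (pow_ne_zero 2 h0.ne') hc.ne'
  have ht : b * (r ^ 2 / c) ≠ 0 := mul_ne_zero hb hy
  simp only [latticeFun_natCast h0 h1 hc hb]
  have hp1 : r ^ 2 < 1 := by nlinarith
  have g1 : 1 ≤ qPochInf (-c) (r ^ 2) := one_le_qPochInf hc.le (by positivity) hp1
  have g2 : 1 ≤ qPochInf (-(r ^ 2 / c)) (r ^ 2) := one_le_qPochInf (by positivity) (by positivity) hp1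
  have g : qPochInf (-c) (r ^ 2) * qPochInf (-(r ^ 2 / c)) (r ^ 2) ≠ 0 := by positivity
  have hlim := (tendsto_scaled_pev_gammaSeries h0 h1 ht rfl).div
    ((tendsto_qPoch hp (-c)).mul_const (qPochInf (-(r ^ 2 / c)) (r ^ 2))) g
  have hp0 := qPochInf_ne_zero_of_norm_lt_one hp hp
  have hr0 := qPochInf_ne_zero_of_norm_lt_one hp hr
  have hval : latticeLim r c b = qPochInf (b * r) (r ^ 2) /
      (qPochInf (r ^ 2) (r ^ 2) * qPochInf r (r ^ 2)) * thetaSum r (b * (r ^ 2 / c)) /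
        (qPochInf (-c) (r ^ 2) * qPochInf (-(r ^ 2 / c)) (r ^ 2)) := by
    rw [thetaSum_eq h0 h1 ht, latticeLim, thetaProd, thetaProd, div_neg, div_neg]
    field_simp
  rw [hval]
  exact hlim

end Asymptotics

/-! ### Summation of products of eigenfunctions -/

section Summation

variable {r : ℝ}

/-- The weight `r^k / (-c r^{2k}; r²)_∞`. -/
noncomputable def latticeWeight (r c : ℝ) (k : ℤ) : ℝ :=
  r ^ k / qPochInf (-(c * r ^ (2 * k))) (r ^ 2)

theorem one_le_qPochInf_weight (h0 : 0 < r) (h1 : r < 1) {c : ℝ} (hc : 0 < c) (k : ℤ) :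
    1 ≤ qPochInf (-(c * r ^ (2 * k))) (r ^ 2) :=
  one_le_qPochInf (mul_pos hc (zpow_pos h0 _)).le (by positivity) (by nlinarith)

theorem latticeWeight_nonneg (h0 : 0 < r) (h1 : r < 1) {c : ℝ} (hc : 0 < c) (k : ℤ) :
    0 ≤ latticeWeight r c k :=
  div_nonneg (zpow_pos h0 k).le (zero_le_one.trans (one_le_qPochInf_weight h0 h1 hc k))

theorem latticeWeight_natCast_le (h0 : 0 < r) (h1 : r < 1) {c : ℝ} (hc : 0 < c) (n : ℕ) :
    latticeWeight r c n ≤ r ^ n := by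
  have := one_le_qPochInf_weight h0 h1 hc n
  rw [latticeWeight, zpow_natCast]
  exact div_le_self (by positivity) this

/-- With r²/c in place of c the nodes become -c r^{-2n}, so `qPochInf_node_natCast` bounds the
denominator of the weight from below. -/
theorem latticeWeight_neg_natCast_le (h0 : 0 < r) (h1 : r < 1) {c : ℝ} (hc : 0 < c) (n : ℕ) :
    latticeWeight r c (-n) ≤ r ^ (n * (n - 1)) * (r / c) ^ n := by
  have hp1 : r ^ 2 < 1 := by nlinarith
  have hc' : r ^ 2 / c ≠ 0 := by positivity
  have h := qPochInf_node_natCast h0 h1 hc' n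
  rw [show r ^ 2 / (r ^ 2 / c) = c by field_simp] at h
  have hnode : node r (r ^ 2 / c) n = -(c * r ^ (2 * -(n : ℤ))) := by
    rw [node, show 2 * (1 - (n : ℤ)) = 2 * -(n : ℤ) + (2 : ℕ) by push_cast; ring,
      zpow_add₀ h0.ne', zpow_natCast]
    field_simp
  rw [hnode] at h
  have g1 : 1 ≤ qPoch (-(r ^ 2 / c)) (r ^ 2) n := one_le_qPoch (by positivity) (by positivity) n
  have g2 : 1 ≤ qPochInf (-c) (r ^ 2) := one_le_qPochInf hc.le (by positivity) hp1
  have hQ := one_le_qPochInf_weight h0 h1 hc (-n)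
  have h3 : 1 ≤ c ^ (-(n : ℤ)) * r ^ (n * (n + 1)) *
      qPochInf (-(c * r ^ (2 * -(n : ℤ)))) (r ^ 2) := by
    rw [h]; exact one_le_mul_of_one_le_of_one_le g1 g2
  have hpow : r ^ n * (r ^ (n * (n - 1)) * (r / c) ^ n) = c ^ (-(n : ℤ)) * r ^ (n * (n + 1)) := by
    rw [zpow_neg, zpow_natCast, div_pow]
    have : r ^ (n * (n + 1)) = r ^ n * r ^ (n * (n - 1)) * r ^ n := by
      rw [← pow_add, ← pow_add]
      congr 1
      cases n with
      | zero => rfl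
      | succ n => simp only [Nat.add_sub_cancel]; ring
    rw [this]
    field_simp
  rw [latticeWeight, div_le_iff₀ (by linarith), zpow_neg, zpow_natCast,
    inv_le_iff_one_le_mul₀ (by positivity)]
  calc 1 ≤ _ := h3
    _ = _ := by rw [← hpow]; ring

theorem zpow_le_zpow_add_zpow {x y z : ℝ} (hx : 0 < x) (hxy : x ≤ y) (hyz : y ≤ z) (j : ℤ) :
    y ^ j ≤ x ^ j + z ^ j := by
  have hy := hx.trans_le hxy
  have hz := hy.trans_le hyz
  have hxj := zpow_pos hx j
  have hzj := zpow_pos hz j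
  obtain ⟨n, rfl | rfl⟩ := j.eq_nat_or_neg
  · have : y ^ (n : ℤ) ≤ z ^ (n : ℤ) := by
      rw [zpow_natCast, zpow_natCast]; gcongr
    linarith
  · have : y ^ (-(n : ℤ)) ≤ x ^ (-(n : ℤ)) := by
      rw [zpow_neg, zpow_neg, zpow_natCast, zpow_natCast]; gcongr
    linarith

/-- The bilateral sum contains negative powers of b, so uniformity requires |b| to stay away from 0
as well as from ∞. The theta series at the two ends of the range together form a majorant. -/
theorem exists_abs_latticeFun_natCast_le (h0 : 0 < r) (h1 : r < 1) {c : ℝ} (hc : 0 < c)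
    {α β : ℝ} (hα : 0 < α) :
    ∃ M, 0 ≤ M ∧ ∀ b : ℝ, α ≤ |b| → |b| ≤ β → ∀ k : ℕ, |latticeFun r c b k| ≤ M := by
  obtain ⟨M, hM0, hM⟩ := exists_abs_rhoInt_le h0 h1 β
  have hp1 : r ^ 2 < 1 := by nlinarith
  have hy : 0 < r ^ 2 / c := by positivity
  by_cases hαβ : α ≤ β
  swap
  · exact ⟨0, le_rfl, fun b h2 h3 => absurd (h2.trans h3) hαβ⟩
  have hβ : 0 < β := hα.trans_le hαβ
  set g : ℤ → ℝ := fun j => M * (r ^ (j * (j - 1)) * (α * (r ^ 2 / c)) ^ j +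
    r ^ (j * (j - 1)) * (β * (r ^ 2 / c)) ^ j) with hg
  have hgs : Summable g := ((summable_theta h0 h1 (by positivity)).add
    (summable_theta h0 h1 (by positivity))).mul_left M
  refine ⟨∑' j, g j, tsum_nonneg fun j => by positivity, fun b h2 h3 k => ?_⟩
  have hb : b ≠ 0 := abs_pos.mp (hα.trans_le h2)
  have ht : b * (r ^ 2 / c) ≠ 0 := mul_ne_zero hb hy.ne'
  have g1 : 1 ≤ qPoch (-c) (r ^ 2) k := one_le_qPoch hc.le (by positivity) k
  have g2 : 1 ≤ qPochInf (-(r ^ 2 / c)) (r ^ 2) := one_le_qPochInf hy.le (by positivity) hp1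
  rw [latticeFun_natCast h0 h1 hc hb, scaled_pev_gammaSeries h0 h1 ht rfl, abs_div]
  refine (div_le_self (abs_nonneg _) ?_).trans ?_
  · exact (one_le_mul_of_one_le_of_one_le g1 g2).trans (le_abs_self _)
  · rw [← Real.norm_eq_abs]
    refine tsum_of_norm_bounded hgs.hasSum fun j => ?_
    rw [norm_mul, norm_mul, norm_zpow, norm_zpow, Real.norm_of_nonneg h0.le, hg]
    dsimp only
    rw [← mul_add]
    gcongr
    · exact hM b h3 _
    · refine zpow_le_zpow_add_zpow (by positivity) ?_ ?_ j
      · rw [Real.norm_eq_abs, abs_mul, abs_of_pos hy]; gcongr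
      · rw [Real.norm_eq_abs, abs_mul, abs_of_pos hy]; gcongr

/-- For these indices the nodes stay in a fixed disc, where Γ_b is bounded; only the prefactor b^n
can grow. -/
theorem exists_abs_latticeFun_neg_natCast_le (h0 : 0 < r) (h1 : r < 1) {c : ℝ} (hc : 0 < c)
    (β : ℝ) : ∃ M, 0 ≤ M ∧ ∀ b : ℝ, |b| ≤ β → ∀ n : ℕ, |latticeFun r c b (-n)| ≤ M * β ^ n := by
  have hr := norm_lt_one_of_pos h0 h1
  obtain ⟨M, hM0, hM⟩ := exists_norm_coeff_rhoSeries_le hr β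
  have hgs : Summable fun n : ℕ => M * (r ^ (n * (n - 1)) * |β * (r ^ 2 / c)| ^ n) :=
    (summable_pow_mul_pred_mul_pow h0.le h1 (β * (r ^ 2 / c))).mul_left M
  refine ⟨∑' n : ℕ, M * (r ^ (n * (n - 1)) * |β * (r ^ 2 / c)| ^ n),
    tsum_nonneg fun j => by positivity, fun b hb n => ?_⟩
  have hβ : 0 ≤ β := (abs_nonneg b).trans hb
  have hQ := one_le_qPochInf_node h0 h1 hc (-n)
  have hz : ‖node r c (-n)‖ ≤ r ^ 2 / c := by
    rw [node, norm_neg, Real.norm_of_nonneg (by positivity), sub_neg_eq_add,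
      show 2 * (1 + (n : ℤ)) = ((2 * (1 + n) : ℕ) : ℤ) by push_cast; rfl, zpow_natCast]
    gcongr ?_ / c
    exact pow_le_pow_of_le_one h0.le h1.le (by omega)
  rw [latticeFun, neg_neg, zpow_natCast, abs_mul, abs_pow, abs_div, mul_comm]
  refine mul_le_mul ?_ (by gcongr) (by positivity) (tsum_nonneg fun j => by positivity)
  refine (div_le_self (abs_nonneg _) (hQ.trans (le_abs_self _))).trans ?_
  rw [← Real.norm_eq_abs, pev]
  refine tsum_of_norm_bounded hgs.hasSum fun i => ?_
  rw [norm_coeff_gammaSeries_mul_pow hr, Real.norm_of_nonneg h0.le, abs_of_nonneg (by positivity),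
    abs_of_nonneg (by positivity)]
  have := hM b hb i
  rw [← Real.norm_eq_abs] at hb
  gcongr

/-- A summable majorant for products of eigenfunctions, uniform in the parameters. -/
theorem exists_summable_majorant (h0 : 0 < r) (h1 : r < 1) {c : ℝ} (hc : 0 < c) {α β : ℝ}
    (hα : 0 < α) : ∃ g : ℤ → ℝ, Summable g ∧ ∀ b b' : ℝ, α ≤ |b| → |b| ≤ β → α ≤ |b'| → |b'| ≤ β →
      ∀ k, ‖latticeFun r c b k * latticeFun r c b' k * latticeWeight r c k‖ ≤ g k := by
  obtain ⟨M, hM0, hM⟩ := exists_abs_latticeFun_natCast_le (β := β) h0 h1 hc hα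
  obtain ⟨N, hN0, hN⟩ := exists_abs_latticeFun_neg_natCast_le h0 h1 hc β
  set G : ℕ → ℝ := fun n => N * N * (r ^ (n * (n - 1)) * |β ^ 2 * (r / c)| ^ n) with hG
  have hGs : Summable G := (summable_pow_mul_pred_mul_pow h0.le h1 (β ^ 2 * (r / c))).mul_left _
  -- For k ≥ 0 the functions are bounded and the weight is at most r^k. For k = -n the growth β^{2n}
  -- is beaten by the factor r^{n(n-1)} of the weight.
  refine ⟨fun k => if 0 ≤ k then M * M * r ^ k.toNat else G (-k).toNat, ?_, ?_⟩
  · refine Summable.of_nat_of_neg_add_one ?_ ?_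
    · simpa using (summable_geometric_of_lt_one h0.le h1).mul_left (M * M)
    · refine ((summable_nat_add_iff 1).mpr hGs).congr fun n => ?_
      rw [if_neg (by omega)]
      congr 1
  · intro b b' h2 h3 h4 h5 k
    have hβ : 0 ≤ β := (abs_nonneg b).trans h3
    rw [norm_mul, norm_mul, Real.norm_of_nonneg (latticeWeight_nonneg h0 h1 hc k),
      Real.norm_eq_abs, Real.norm_eq_abs]
    dsimp only
    split_ifs with hk
    · lift k to ℕ using hk
      have e := latticeWeight_natCast_le h0 h1 hc k
      have e' := latticeWeight_nonneg h0 h1 hc k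
      have := hM b h2 h3 k
      have := hM b' h4 h5 k
      rw [Int.toNat_natCast]
      gcongr
    · obtain ⟨n, rfl⟩ : ∃ n : ℕ, k = -n := ⟨(-k).toNat, by omega⟩
      have e := latticeWeight_neg_natCast_le h0 h1 hc n
      have e' := latticeWeight_nonneg h0 h1 hc (-n)
      have := hN b h3 n
      have := hN b' h5 n
      rw [neg_neg, Int.toNat_natCast]
      calc _ ≤ N * β ^ n * (N * β ^ n) * (r ^ (n * (n - 1)) * (r / c) ^ n) := by gcongr
        _ = _ := by
          rw [hG, abs_of_nonneg (by positivity)]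
          ring

theorem summable_latticeFun_mul (h0 : 0 < r) (h1 : r < 1) {c : ℝ} (hc : 0 < c) {b b' : ℝ}
    (hb : b ≠ 0) (hb' : b' ≠ 0) :
    Summable fun k => latticeFun r c b k * latticeFun r c b' k * latticeWeight r c k := by
  obtain ⟨g, hg, h⟩ := exists_summable_majorant (α := min |b| |b'|) (β := max |b| |b'|) h0 h1 hc
    (lt_min (abs_pos.mpr hb) (abs_pos.mpr hb'))
  exact hg.of_norm_bounded
    (h b b' (min_le_left _ _) (le_max_left _ _) (min_le_right _ _) (le_max_right _ _))

/-- The discrete Wronskian of two eigenfunctions, with suitable normalization. -/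
noncomputable def wronskian (r c b b' : ℝ) (k : ℤ) : ℝ :=
  r * ((b - 1) * (latticeFun r c (b * r) k * latticeFun r c b' k) -
    (b' - 1) * (latticeFun r c b k * latticeFun r c (b' * r) k)) /
      qPochInf (-(c * r ^ (2 * k))) (r ^ 2)

/-- In the cross-difference of the two recurrences the common term 1 + r cancels and the difference
of the spectral parameters remains. The q-step of the weight denominator supplies the coefficient 1
+ c r^{2k}. -/
theorem wronskian_sub (h0 : 0 < r) (h1 : r < 1) {c : ℝ} (hc : 0 < c) {b b' : ℝ}
    (hb : b ≠ 0) (hb' : b' ≠ 0) (k : ℤ) :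
    wronskian r c b b' (k + 1) - wronskian r c b b' k =
      c * (1 / b' - 1 / b) *
        (latticeFun r c b k * latticeFun r c b' k * latticeWeight r c k) := by
  -- The usual Wronskian form has the factor r^{-k}, unbounded as k → ∞. The definition absorbs it
  -- through `latticeFun_sub_succ`, so that the limit can be taken factor by factor.
  have repr : ∀ k, wronskian r c b b' k = r * r ^ (-k) *
      (latticeFun r c b (k - 1) * latticeFun r c b' k -
        latticeFun r c b k * latticeFun r c b' (k - 1)) /
      qPochInf (-(c * r ^ (2 * k))) (r ^ 2) := fun k => by
    have l1 := latticeFun_sub_succ h0 h1 hc hb (k - 1)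
    have l2 := latticeFun_sub_succ h0 h1 hc hb' (k - 1)
    rw [sub_add_cancel] at l1 l2
    have hk : r ^ (-k) * r ^ k = 1 := by rw [← zpow_add₀ h0.ne']; simp
    rw [wronskian]
    congr 1
    linear_combination (-(r * r ^ (-k) * latticeFun r c b' k)) * l1 +
      (r * r ^ (-k) * latticeFun r c b k) * l2 -
      r * ((b - 1) * (latticeFun r c (b * r) k * latticeFun r c b' k) -
        (b' - 1) * (latticeFun r c b k * latticeFun r c (b' * r) k)) * hk
  have hQ := one_le_qPochInf_weight h0 h1 hc (k + 1)
  have hstep : qPochInf (-(c * r ^ (2 * k))) (r ^ 2) =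
      (1 + c * r ^ (2 * k)) * qPochInf (-(c * r ^ (2 * (k + 1)))) (r ^ 2) := by
    rw [qPochInf_step (norm_sq_lt_one (norm_lt_one_of_pos h0 h1)), mul_add, zpow_add₀ h0.ne',
      sub_neg_eq_add]
    norm_cast
    ring_nf
  have hx : 0 < c * r ^ (2 * k) := mul_pos hc (zpow_pos h0 _)
  have hr2 : r ^ (2 * k) = r ^ k * r ^ k := by rw [two_mul, zpow_add₀ h0.ne']
  have e1 : r * r ^ (-(k + 1)) = (r ^ k)⁻¹ := by
    rw [← zpow_neg, ← zpow_one_add₀ h0.ne']; congr 1; ring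
  have e2 : r ^ (-k) = (r ^ k)⁻¹ := zpow_neg r k
  have r1 := latticeFun_recurrence h0 h1 hc hb k
  have r2 := latticeFun_recurrence h0 h1 hc hb' k
  rw [repr, repr, latticeWeight, hstep, e1, e2, add_sub_cancel_right]
  have hrk : r ^ k ≠ 0 := zpow_ne_zero _ h0.ne'
  rw [hr2] at hx r1 r2 ⊢
  clear hstep repr hr2 e1 e2
  generalize qPochInf (-(c * r ^ (2 * (k + 1)))) (r ^ 2) = Q at *
  generalize r ^ k = s at *
  have hQ0 : Q ≠ 0 := by linarith
  have hx0 : 1 + c * (s * s) ≠ 0 := by linarith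
  field_simp
  field_simp at r1 r2
  linear_combination b' * latticeFun r c b' k * r1 - b * latticeFun r c b k * r2

theorem tendsto_qPochInf_weight (h0 : 0 < r) (h1 : r < 1) {c : ℝ} (hc : 0 < c) :
    Tendsto (fun n : ℕ => qPochInf (-(c * r ^ (2 * (n : ℤ)))) (r ^ 2)) atTop (𝓝 1) := by
  have hp := norm_sq_lt_one (norm_lt_one_of_pos h0 h1)
  have hc1 : 1 ≤ qPochInf (-c) (r ^ 2) := one_le_qPochInf hc.le (by positivity) (by nlinarith)
  have h := (tendsto_const_nhds (x := qPochInf (-c) (r ^ 2))).div (tendsto_qPoch hp (-c))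
    (by linarith)
  rw [div_self (by linarith)] at h
  refine h.congr fun n => ?_
  have := one_le_qPoch hc.le (sq_nonneg r) n
  rw [qPochInf_eq hp (-c) n, Pi.div_apply, mul_div_cancel_left₀ _ (by linarith), zpow_mul,
    zpow_natCast]
  norm_cast
  rw [neg_mul]

theorem tendsto_wronskian (h0 : 0 < r) (h1 : r < 1) {c : ℝ} (hc : 0 < c) {b b' : ℝ}
    (hb : b ≠ 0) (hb' : b' ≠ 0) :
    Tendsto (fun n : ℕ => wronskian r c b b' n) atTop
      (𝓝 (r * ((b - 1) * (latticeLim r c (b * r) * latticeLim r c b') -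
        (b' - 1) * (latticeLim r c b * latticeLim r c (b' * r))))) := by
  have a := fun {x : ℝ} (hx : x ≠ 0) => tendsto_latticeFun h0 h1 hc hx
  have hr0 := h0.ne'
  have h := ((((a (mul_ne_zero hb hr0)).mul (a hb')).const_mul (b - 1)).sub
    (((a hb).mul (a (mul_ne_zero hb' hr0))).const_mul (b' - 1))).const_mul r
  simpa [wronskian, Pi.div_def] using h.div (tendsto_qPochInf_weight h0 h1 hc) one_ne_zero

/-- At -n the reciprocal of the infinite product is r^n times the weight, so the Wronskian is r^n
times a combination of terms of summable series. -/
theorem tendsto_wronskian_neg (h0 : 0 < r) (h1 : r < 1) {c : ℝ} (hc : 0 < c) {b b' : ℝ}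
    (hb : b ≠ 0) (hb' : b' ≠ 0) :
    Tendsto (fun n : ℕ => wronskian r c b b' (-n)) atTop (𝓝 0) := by
  have a : ∀ {x y : ℝ}, x ≠ 0 → y ≠ 0 → Tendsto (fun n : ℕ => r ^ n *
      (latticeFun r c x (-n) * latticeFun r c y (-n) * latticeWeight r c (-n))) atTop (𝓝 0) :=
    fun {x y} hx hy => by
      have hinj : Function.Injective fun n : ℕ => -(n : ℤ) := fun m n h => by simpa using h
      have := ((summable_latticeFun_mul h0 h1 hc hx hy).comp_injective hinj).tendsto_atTop_zero
      simpa using (tendsto_pow_atTop_nhds_zero_of_lt_one h0.le h1).mul this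
  have hr0 := h0.ne'
  have h := (((a (mul_ne_zero hb hr0) hb').const_mul (b - 1)).sub
    ((a hb (mul_ne_zero hb' hr0)).const_mul (b' - 1))).const_mul r
  simp only [mul_zero, sub_zero] at h
  refine h.congr fun n => ?_
  have : r ^ n ≠ 0 := pow_ne_zero _ hr0
  rw [wronskian, latticeWeight, zpow_neg, zpow_natCast]
  field_simp

/-- The sum of the products of two eigenfunctions with parameters `b` and `b'`. -/
theorem hasSum_latticeFun_mul (h0 : 0 < r) (h1 : r < 1) {c : ℝ} (hc : 0 < c) {b b' : ℝ}
    (hb : b ≠ 0) (hb' : b' ≠ 0) :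
    HasSum (fun k => c * (1 / b' - 1 / b) *
        (latticeFun r c b k * latticeFun r c b' k * latticeWeight r c k))
      (r * ((b - 1) * (latticeLim r c (b * r) * latticeLim r c b') -
        (b' - 1) * (latticeLim r c b * latticeLim r c (b' * r)))) := by
  have hs := (summable_latticeFun_mul h0 h1 hc hb hb').mul_left (c * (1 / b' - 1 / b))
  have hw := wronskian_sub h0 h1 hc hb hb'
  simp only [← hw] at hs ⊢
  -- The bilateral sum is telescoped separately over k ≥ 0 and k < 0; the values at 0 cancel.
  have p1 : HasSum (fun n : ℕ => wronskian r c b b' ((n : ℤ) + 1) - wronskian r c b b' n)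
      (r * ((b - 1) * (latticeLim r c (b * r) * latticeLim r c b') -
        (b' - 1) * (latticeLim r c b * latticeLim r c (b' * r))) - wronskian r c b b' 0) := by
    have hs1 := hs.comp_injective (i := fun n : ℕ => (n : ℤ)) Nat.cast_injective
    refine (hs1.hasSum_iff_tendsto_nat).mpr ?_
    refine ((tendsto_wronskian h0 h1 hc hb hb').sub_const _).congr fun N => ?_
    have := Finset.sum_range_sub (fun n : ℕ => wronskian r c b b' n) N
    simpa using this.symm
  have p2 : HasSum (fun n : ℕ => wronskian r c b b' (-((n : ℤ) + 1) + 1) -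
      wronskian r c b b' (-((n : ℤ) + 1))) (wronskian r c b b' 0 - 0) := by
    have hinj : Function.Injective fun n : ℕ => -((n : ℤ) + 1) := fun m n h => by simpa using h
    have hs2 := hs.comp_injective hinj
    refine (hs2.hasSum_iff_tendsto_nat).mpr ?_
    refine ((tendsto_wronskian_neg h0 h1 hc hb hb').const_sub _).congr fun N => ?_
    have := Finset.sum_range_sub' (fun n : ℕ => wronskian r c b b' (-n)) N
    simpa using this.symm
  have := p1.of_nat_of_neg_add_one (f := fun k => wronskian r c b b' (k + 1) - wronskian r c b b' k)
    p2
  simpa using this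

theorem continuous_coeff_gammaSeries (r : ℝ) (n : ℕ) :
    Continuous fun b => coeff n (gammaSeries r b) := by
  simp only [gammaSeries, coeff_mul, phiSeries, coeff_mk, qPoch]
  fun_prop

theorem continuousAt_latticeFun (h0 : 0 < r) (h1 : r < 1) (c : ℝ) {b : ℝ} (hb : b ≠ 0) (k : ℤ) :
    ContinuousAt (fun x => latticeFun r c x k) b := by
  have hr := norm_lt_one_of_pos h0 h1
  obtain ⟨M, hM0, hM⟩ := exists_norm_coeff_rhoSeries_le hr (|b| + 1)
  have hG : ContinuousAt (fun x => pev (gammaSeries r x) (node r c k)) b := by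
    refine tendsto_tsum_of_dominated_convergence
      ((summable_pow_mul_pred_mul_pow h0.le h1 ((|b| + 1) * ‖node r c k‖)).mul_left M)
      (fun n => ((continuous_coeff_gammaSeries r n).tendsto b).mul_const _) ?_
    have hev : ∀ᶠ x in 𝓝 b, |x| < |b| + 1 :=
      (continuous_abs.tendsto b).eventually_lt_const (by linarith)
    filter_upwards [hev] with x hx n
    have hx' : ‖x‖ ≤ |b| + 1 := hx.le
    have := hM x hx' n
    rw [norm_coeff_gammaSeries_mul_pow hr, Real.norm_of_nonneg h0.le,
      abs_of_nonneg (by positivity), abs_of_nonneg (by positivity)]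
    gcongr
  exact (continuousAt_zpow₀ b (-k) (Or.inl hb)).mul (hG.div_const _)

/-- The squared norm of an eigenfunction as a limit of inner products. -/
theorem hasSum_latticeFun_sq (h0 : 0 < r) (h1 : r < 1) {c : ℝ} (hc : 0 < c) {b N : ℝ}
    (hb : b ≠ 0)
    (hN : Tendsto (fun b' => r * ((b - 1) * (latticeLim r c (b * r) * latticeLim r c b') -
        (b' - 1) * (latticeLim r c b * latticeLim r c (b' * r))) / (c * (1 / b' - 1 / b)))
      (𝓝[≠] b) (𝓝 N)) :
    HasSum (fun k => latticeFun r c b k * latticeFun r c b k * latticeWeight r c k) N := by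
  have hb2 : 0 < |b| := abs_pos.mpr hb
  -- The range |b|/2 to 2|b| leaves room around b, so a single majorant serves for all b' near b.
  obtain ⟨g, hg, hle⟩ := exists_summable_majorant (α := |b| / 2) (β := 2 * |b|) h0 h1 hc
    (by positivity)
  have hlim : Tendsto (fun b' => ∑' k, latticeFun r c b k * latticeFun r c b' k *
      latticeWeight r c k) (𝓝[≠] b)
      (𝓝 (∑' k, latticeFun r c b k * latticeFun r c b k * latticeWeight r c k)) := by
    refine tendsto_nhdsWithin_of_tendsto_nhds ?_
    refine tendsto_tsum_of_dominated_convergence hg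
      (fun k => ((continuousAt_latticeFun h0 h1 c hb k).const_mul _).mul_const _) ?_
    have hev : ∀ᶠ x in 𝓝 b, |x| < 2 * |b| :=
      (continuous_abs.tendsto b).eventually_lt_const (by linarith)
    have hev' : ∀ᶠ x in 𝓝 b, |b| / 2 < |x| :=
      (continuous_abs.tendsto b).eventually_const_lt (by linarith)
    filter_upwards [hev, hev'] with x h2 h3 k
    exact hle b x (by linarith) (by linarith) h3.le h2.le k
  have hev : ∀ᶠ b' in 𝓝[≠] b, b' ≠ 0 ∧ b' ≠ b :=
    ((isOpen_ne.eventually_mem hb).filter_mono nhdsWithin_le_nhds).and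
      self_mem_nhdsWithin
  have heq : ∑' k, latticeFun r c b k * latticeFun r c b k * latticeWeight r c k = N := by
    refine tendsto_nhds_unique hlim (hN.congr' ?_)
    filter_upwards [hev] with b' ⟨h2, h3⟩
    have hne : c * (1 / b' - 1 / b) ≠ 0 := by
      refine mul_ne_zero hc.ne' (sub_ne_zero.mpr fun h => h3 ?_)
      rwa [one_div, one_div, inv_inj] at h
    rw [div_eq_iff hne, ← (hasSum_latticeFun_mul h0 h1 hc hb h2).tsum_eq, tsum_mul_left, mul_comm]
  rw [← heq]
  exact (summable_latticeFun_mul h0 h1 hc hb hb).hasSum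

end Summation

/-! ### Theta values and norms -/

section Norms

variable {r : ℝ}

theorem continuous_qPochInf (h0 : 0 < r) (h1 : r < 1) :
    Continuous fun x : ℝ => qPochInf x (r ^ 2) := by
  have hr := norm_lt_one_of_pos h0 h1
  simp only [← pev_eulerSeries hr]
  refine continuous_iff_continuousAt.mpr fun z => ?_
  refine tendsto_tsum_of_dominated_convergence (absConv_eulerSeries hr (|z| + 1))
    (fun n => (tendsto_id.pow n).const_mul _) ?_
  have hev : ∀ᶠ x in 𝓝 z, |x| < |z| + 1 :=
    (continuous_abs.tendsto z).eventually_lt_const (by linarith)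
  filter_upwards [hev] with x hx n
  rw [norm_mul, norm_mul, norm_pow, norm_pow, Real.norm_of_nonneg (by positivity : 0 ≤ |z| + 1)]
  gcongr
  exact hx.le

theorem thetaProd_div_sq (h0 : 0 < r) (h1 : r < 1) {x : ℝ} (hx : x ≠ 0) :
    thetaProd r (x / r ^ 2) = -(x / r ^ 2) * thetaProd r x := by
  have hp := norm_sq_lt_one (norm_lt_one_of_pos h0 h1)
  have hr2 : r ^ 2 ≠ 0 := pow_ne_zero 2 h0.ne'
  have e1 := qPochInf_step hp (x / r ^ 2)
  have e2 := qPochInf_step hp (r ^ 2 / x)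
  rw [div_mul_cancel₀ _ hr2] at e1
  have e3 : r ^ 2 / (x / r ^ 2) = r ^ 2 / x * r ^ 2 := by field_simp
  rw [thetaProd, thetaProd, e1, e2, e3]
  field_simp
  ring

theorem thetaProd_mul_zpow (h0 : 0 < r) (h1 : r < 1) {x : ℝ} (hx : x ≠ 0) (j : ℤ) :
    thetaProd r (x * r ^ (-2 * j)) = (-x) ^ j * r ^ (-(j * (j + 1))) * thetaProd r x := by
  have step : ∀ j : ℤ, thetaProd r (x * r ^ (-2 * (j + 1))) =
      -(x * r ^ (-2 * (j + 1))) * thetaProd r (x * r ^ (-2 * j)) := fun j => by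
    have e : x * r ^ (-2 * (j + 1)) = x * r ^ (-2 * j) / r ^ 2 := by
      rw [show -2 * (j + 1) = -2 * j - (2 : ℕ) by push_cast; ring, zpow_sub₀ h0.ne', zpow_natCast]
      ring
    rw [e]
    exact thetaProd_div_sq h0 h1 (mul_ne_zero hx (zpow_ne_zero _ h0.ne'))
  have fac : ∀ j : ℤ, (-x) ^ (j + 1) * r ^ (-((j + 1) * (j + 1 + 1))) =
      -(x * r ^ (-2 * (j + 1))) * ((-x) ^ j * r ^ (-(j * (j + 1)))) := fun j => by
    rw [zpow_add_one₀ (neg_ne_zero.mpr hx),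
      show -((j + 1) * (j + 1 + 1)) = -2 * (j + 1) + -(j * (j + 1)) by ring, zpow_add₀ h0.ne']
    ring
  induction j with
  | zero => simp
  | succ i ih => rw [step, ih, fac]; ring
  | pred i ih =>
    have h := step (-(i : ℤ) - 1)
    have hf := fac (-(i : ℤ) - 1)
    rw [sub_add_cancel] at h hf
    have hne : -(x * r ^ (-2 * (-(i : ℤ)))) ≠ 0 :=
      neg_ne_zero.mpr (mul_ne_zero hx (zpow_ne_zero _ h0.ne'))
    rw [ih, hf, mul_assoc] at h
    rw [sub_add_cancel]
    exact (mul_left_cancel₀ hne h).symm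

theorem qPochInf_one (h0 : 0 < r) (h1 : r < 1) : qPochInf (1 : ℝ) (r ^ 2) = 0 := by
  rw [qPochInf_step (norm_sq_lt_one (norm_lt_one_of_pos h0 h1)), sub_self, zero_mul]

theorem thetaProd_even_zpow (h0 : 0 < r) (h1 : r < 1) {l : ℤ} (hl : Even l) :
    thetaProd r (r ^ l) = 0 := by
  obtain ⟨j, rfl⟩ := hl
  have := thetaProd_mul_zpow h0 h1 one_ne_zero (-j)
  rw [one_mul, show -2 * -j = j + j by ring] at this
  rw [this, thetaProd, qPochInf_one h0 h1]
  ring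

theorem thetaProd_self (h0 : 0 < r) : thetaProd r r = qPochInf r (r ^ 2) ^ 2 := by
  rw [thetaProd, show r ^ 2 / r = r by field_simp, ← sq]

theorem thetaProd_eq_one_sub_mul (h0 : 0 < r) (h1 : r < 1) (x : ℝ) :
    thetaProd r x = (1 - x) * (qPochInf (x * r ^ 2) (r ^ 2) * qPochInf (r ^ 2 / x) (r ^ 2)) := by
  rw [thetaProd, qPochInf_step (norm_sq_lt_one (norm_lt_one_of_pos h0 h1)) x, mul_assoc]

theorem thetaProd_neg_pos (h0 : 0 < r) (h1 : r < 1) {x : ℝ} (hx : 0 < x) :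
    0 < thetaProd r (-x) := by
  have hp1 : r ^ 2 < 1 := by nlinarith
  have e1 := one_le_qPochInf hx.le (sq_nonneg r) hp1
  have e2 := one_le_qPochInf (x := r ^ 2 / x) (by positivity) (sq_nonneg r) hp1
  rw [thetaProd, div_neg]
  positivity

/-- The parameter `-c r^{-m}` of the `m`-th eigenfunction. -/
noncomputable def param (r c : ℝ) (m : ℤ) : ℝ := -(c * r ^ (-m))

theorem param_ne_zero (h0 : 0 < r) {c : ℝ} (hc : 0 < c) (m : ℤ) : param r c m ≠ 0 :=
  neg_ne_zero.mpr (mul_pos hc (zpow_pos h0 _)).ne'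

theorem param_mul (h0 : 0 < r) (c : ℝ) (m : ℤ) : param r c m * r = param r c (m - 1) := by
  rw [param, param, show -(m - 1) = -m + 1 by ring, zpow_add_one₀ h0.ne']
  ring

theorem latticeLim_param_mul (h0 : 0 < r) {c : ℝ} (hc : 0 < c) (m : ℤ) (x : ℝ) :
    latticeLim r c (param r c m * x) = qPochInf (param r c m * x * r) (r ^ 2) / qPochInf r (r ^ 2) *
      (thetaProd r (x * r ^ (2 - m)) / thetaProd r (-c)) := by
  have : -(param r c m * x * (r ^ 2 / c)) = x * r ^ (2 - m) := by
    rw [param, show 2 - m = -m + (2 : ℕ) by push_cast; ring, zpow_add₀ h0.ne', zpow_natCast]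
    field_simp
  rw [latticeLim, this]

theorem latticeLim_param (h0 : 0 < r) {c : ℝ} (hc : 0 < c) (m : ℤ) :
    latticeLim r c (param r c m) = qPochInf (param r c m * r) (r ^ 2) / qPochInf r (r ^ 2) *
      (thetaProd r (r ^ (2 - m)) / thetaProd r (-c)) := by
  simpa using latticeLim_param_mul h0 hc m 1

theorem latticeLim_param_of_even (h0 : 0 < r) (h1 : r < 1) {c : ℝ} (hc : 0 < c) {m : ℤ}
    (hm : Even m) : latticeLim r c (param r c m) = 0 := by
  rw [latticeLim_param h0 hc, thetaProd_even_zpow h0 h1 (even_two.sub hm)]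
  simp

/-- The squared norm of the `m`-th eigenfunction on one half of the lattice. -/
noncomputable def halfNorm (r c : ℝ) (m : ℤ) : ℝ :=
  qPochInf (r ^ 2) (r ^ 2) ^ 2 * thetaProd r (-(c * r)) / thetaProd r (-c) *
    (c ^ m * r ^ (-(m ^ 2))) /
      (qPochInf (-(c⁻¹ * r ^ (m + 1))) (r ^ 2) * qPochInf (-(c⁻¹ * r ^ (m + 1)) * r) (r ^ 2))

/-- The two products in the denominator of `halfNorm` are the complementary factors of θ(b) and
θ(br), because r²/(br) = -c⁻¹ r^{m+1} and r²/b = -c⁻¹ r^{m+2}. -/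
theorem qPochInf_mul_param (h0 : 0 < r) {c : ℝ} (hc : 0 < c) (m : ℤ) :
    (qPochInf (-(c⁻¹ * r ^ (m + 1))) (r ^ 2) * qPochInf (-(c⁻¹ * r ^ (m + 1)) * r) (r ^ 2)) *
      (qPochInf (param r c m) (r ^ 2) * qPochInf (param r c m * r) (r ^ 2)) =
    thetaProd r (param r c m) * thetaProd r (param r c m * r) := by
  have hrm : r ^ m ≠ 0 := zpow_ne_zero _ h0.ne'
  have e1 : r ^ 2 / param r c m = -(c⁻¹ * r ^ (m + 1)) * r := by
    rw [param, zpow_neg, zpow_add_one₀ h0.ne']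
    field_simp
  have e2 : r ^ 2 / (param r c m * r) = -(c⁻¹ * r ^ (m + 1)) := by
    rw [param, zpow_neg, zpow_add_one₀ h0.ne']
    field_simp
  rw [thetaProd, thetaProd, e1, e2]
  ring

theorem one_le_qPochInf_param (h0 : 0 < r) (h1 : r < 1) {c : ℝ} (hc : 0 < c) (m : ℤ) :
    1 ≤ qPochInf (param r c m) (r ^ 2) :=
  one_le_qPochInf (mul_pos hc (zpow_pos h0 _)).le (by positivity) (by nlinarith)

/-- Brings the norm to the shape produced by the limit b' → b. Here u is the power of r left over by
quasi-periodicity, whose exponent is computed separately for each parity of m. -/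
theorem halfNorm_eq (h0 : 0 < r) (h1 : r < 1) {c : ℝ} (hc : 0 < c) {m : ℤ} {u : ℝ}
    (hu : thetaProd r (param r c m) * thetaProd r (param r c m * r) =
      c ^ m * u * (thetaProd r (-c) * thetaProd r (-(c * r)))) :
    halfNorm r c m = qPochInf (r ^ 2) (r ^ 2) ^ 2 *
      (qPochInf (param r c m) (r ^ 2) * qPochInf (param r c m * r) (r ^ 2)) /
        thetaProd r (-c) ^ 2 * (r ^ (-(m ^ 2)) / u) := by
  have hP := one_le_qPochInf_param h0 h1 hc m
  have hP' := one_le_qPochInf_param h0 h1 hc (m - 1)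
  rw [← param_mul h0] at hP'
  have hθ := thetaProd_neg_pos h0 h1 hc
  have hθ' := thetaProd_neg_pos h0 h1 (mul_pos hc h0)
  have hcm : 0 < c ^ m := zpow_pos hc m
  have hθb : thetaProd r (param r c m) * thetaProd r (param r c m * r) ≠ 0 := by
    rw [param_mul h0, param, param]
    exact (mul_pos (thetaProd_neg_pos h0 h1 (mul_pos hc (zpow_pos h0 _)))
      (thetaProd_neg_pos h0 h1 (mul_pos hc (zpow_pos h0 _)))).ne'
  have hx := qPochInf_mul_param h0 hc m
  rw [hu] at hx hθb
  have hu0 : u ≠ 0 := fun h => hθb (by rw [h]; ring)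
  have hx0 : qPochInf (-(c⁻¹ * r ^ (m + 1))) (r ^ 2) *
      qPochInf (-(c⁻¹ * r ^ (m + 1)) * r) (r ^ 2) ≠ 0 := fun h => hθb (by rw [← hx, h, zero_mul])
  rw [halfNorm, div_eq_iff hx0]
  generalize qPochInf (-(c⁻¹ * r ^ (m + 1))) (r ^ 2) *
      qPochInf (-(c⁻¹ * r ^ (m + 1)) * r) (r ^ 2) = Y at *
  have hP0 : qPochInf (param r c m) (r ^ 2) ≠ 0 := by linarith
  have hP0' : qPochInf (param r c m * r) (r ^ 2) ≠ 0 := by linarith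
  generalize qPochInf (param r c m) (r ^ 2) = A at *
  generalize qPochInf (param r c m * r) (r ^ 2) = B at *
  generalize thetaProd r (-(c * r)) = V at *
  generalize qPochInf (r ^ 2) (r ^ 2) = W at *
  field_simp
  linear_combination (-W ^ 2) * hx

/-- Quasi-periodicity reduces to the simple zero of θ at 1: the factor 1 - x cancels, and the
remaining products at x = 1 are both (p;p)_∞. -/
theorem tendsto_thetaProd_div (h0 : 0 < r) (h1 : r < 1) {g : ℝ → ℝ} (hg : ContinuousAt g 1)
    (j : ℤ) : Tendsto (fun x => g x * (thetaProd r (x * r ^ (-2 * j)) / (1 - x))) (𝓝[≠] 1)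
      (𝓝 (g 1 * ((-1) ^ j * r ^ (-(j * (j + 1))) * qPochInf (r ^ 2) (r ^ 2) ^ 2))) := by
  have hq := continuous_qPochInf h0 h1
  have hc : ContinuousAt (fun x : ℝ => g x * ((-x) ^ j * r ^ (-(j * (j + 1))) *
      (qPochInf (x * r ^ 2) (r ^ 2) * qPochInf (r ^ 2 / x) (r ^ 2)))) 1 := by
    have c1 : ContinuousAt (fun x : ℝ => (-x) ^ j) 1 :=
      (continuousAt_zpow₀ _ j (Or.inl (by norm_num))).comp continuousAt_neg
    have c2 : ContinuousAt (fun x : ℝ => qPochInf (x * r ^ 2) (r ^ 2)) 1 :=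
      (hq.comp (continuous_mul_const (r ^ 2))).continuousAt
    have c3 : ContinuousAt (fun x : ℝ => qPochInf (r ^ 2 / x) (r ^ 2)) 1 :=
      hq.continuousAt.comp (continuousAt_const.div continuousAt_id one_ne_zero)
    exact hg.mul ((c1.mul_const _).mul (c2.mul c3))
  have hlim := hc.tendsto.mono_left (nhdsWithin_le_nhds (s := {1}ᶜ))
  simp only [one_mul, div_one, ← sq] at hlim
  refine hlim.congr' ?_
  filter_upwards [self_mem_nhdsWithin,
    nhdsWithin_le_nhds (isOpen_ne.mem_nhds (one_ne_zero : (1 : ℝ) ≠ 0))] with x hx hx0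
  have hx1 : 1 - x ≠ 0 := sub_ne_zero.mpr (Ne.symm hx)
  rw [thetaProd_mul_zpow h0 h1 hx0, thetaProd_eq_one_sub_mul h0 h1]
  congr 1
  rw [eq_div_iff hx1]
  ring

/-- With b' = bx one has 1/(c(1/b' - 1/b)) = bx/(c(1-x)), so it suffices to exhibit the theta factor
of the boundary term that vanishes at x = 1. -/
theorem hasSum_latticeFun_sq' (h0 : 0 < r) (h1 : r < 1) {c : ℝ} (hc : 0 < c) {b : ℝ}
    (hb : b ≠ 0) {g : ℝ → ℝ} (hg : ContinuousAt g 1) {j : ℤ}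
    (h : ∀ x, r * ((b - 1) * (latticeLim r c (b * r) * latticeLim r c (b * x)) -
        (b * x - 1) * (latticeLim r c b * latticeLim r c (b * x * r))) * (b * x / c) =
      g x * thetaProd r (x * r ^ (-2 * j))) :
    HasSum (fun k => latticeFun r c b k * latticeFun r c b k * latticeWeight r c k)
      (g 1 * ((-1) ^ j * r ^ (-(j * (j + 1))) * qPochInf (r ^ 2) (r ^ 2) ^ 2)) := by
  refine hasSum_latticeFun_sq h0 h1 hc hb ?_
  have hmap : Tendsto (fun b' => b' / b) (𝓝[≠] b) (𝓝[≠] 1) := by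
    refine tendsto_nhdsWithin_iff.mpr ⟨?_, ?_⟩
    · have : Tendsto (fun b' => b' / b) (𝓝 b) (𝓝 (b / b)) := tendsto_id.div_const b
      rw [div_self hb] at this
      exact this.mono_left nhdsWithin_le_nhds
    · filter_upwards [self_mem_nhdsWithin] with x hx
      exact fun h => hx ((div_eq_one_iff_eq hb).mp h)
  refine ((tendsto_thetaProd_div h0 h1 hg j).comp hmap).congr' ?_
  filter_upwards [self_mem_nhdsWithin,
    nhdsWithin_le_nhds (isOpen_ne.mem_nhds hb)] with b' hb' hb0
  have hx := h (b' / b)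
  rw [mul_div_cancel₀ _ hb] at hx
  have hne : b - b' ≠ 0 := sub_ne_zero.mpr (Ne.symm hb')
  have hb0' : b' ≠ 0 := hb0
  rw [Function.comp_apply, ← mul_div_assoc, ← hx]
  generalize r * ((b - 1) * (latticeLim r c (b * r) * latticeLim r c b') -
        (b' - 1) * (latticeLim r c b * latticeLim r c (b' * r))) = Z
  field_simp

theorem neg_one_zpow_mul_self (j : ℤ) : (-1 : ℝ) ^ j * (-1) ^ j = 1 := by
  rw [← mul_zpow]; simp

theorem neg_zpow_eq (x : ℝ) (j : ℤ) : (-x) ^ j = (-1) ^ j * x ^ j := by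
  rw [← mul_zpow, neg_one_mul]

theorem hasSum_param_sq_of_odd (h0 : 0 < r) (h1 : r < 1) {c : ℝ} (hc : 0 < c) (j : ℤ) :
    HasSum (fun k => latticeFun r c (param r c (2 * j + 1)) k *
      latticeFun r c (param r c (2 * j + 1)) k * latticeWeight r c k)
      (halfNorm r c (2 * j + 1)) := by
  have hr0 := h0.ne'
  have hp := norm_sq_lt_one (norm_lt_one_of_pos h0 h1)
  have hq := continuous_qPochInf h0 h1
  have hR := qPochInf_ne_zero_of_norm_lt_one hp (norm_lt_one_of_pos h0 h1)
  have hθ := thetaProd_neg_pos h0 h1 hc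
  set m : ℤ := 2 * j + 1 with hm
  set b := param r c m with hb
  -- For odd m the first product of the boundary term drops out; the second carries the zero at x =
  -- 1 in L(bxr).
  have hA : latticeLim r c (b * r) = 0 := by
    rw [hb, param_mul h0]
    exact latticeLim_param_of_even h0 h1 hc (by rw [hm]; simp)
  have hu : thetaProd r b * thetaProd r (b * r) =
      c ^ m * r ^ (-((j + 1) * (2 * j + 1))) * (thetaProd r (-c) * thetaProd r (-(c * r))) := by
    have e1 : b = -(c * r) * r ^ (-2 * (j + 1)) := by
      rw [hb, param, show -m = 1 + -2 * (j + 1) by rw [hm]; ring, zpow_add₀ hr0, zpow_one]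
      ring
    have e2 : b * r = -c * r ^ (-2 * j) := by
      rw [hb, param_mul h0, param, show -(m - 1) = -2 * j by rw [hm]; ring]
      ring
    have e3 : c ^ m = c ^ (j + 1) * c ^ j := by
      rw [← zpow_add₀ hc.ne']; congr 1; rw [hm]; ring
    have e4 : r ^ (-((j + 1) * (2 * j + 1))) =
        r ^ (j + 1) * r ^ (-((j + 1) * (j + 1 + 1))) * r ^ (-(j * (j + 1))) := by
      rw [← zpow_add₀ hr0, ← zpow_add₀ hr0]; congr 1; ring
    rw [e2, e1, thetaProd_mul_zpow h0 h1 (neg_ne_zero.mpr (mul_pos hc h0).ne'),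
      thetaProd_mul_zpow h0 h1 (neg_ne_zero.mpr hc.ne'), neg_neg, neg_neg, mul_zpow, e3, e4]
    ring
  have key := hasSum_latticeFun_sq' h0 h1 hc (param_ne_zero h0 hc m) (j := j - 1)
    (g := fun x => -(r * (b * x - 1) * latticeLim r c b * (b * x / c) *
      qPochInf (b * r ^ 2 * x) (r ^ 2) / (qPochInf r (r ^ 2) * thetaProd r (-c)))) ?_ ?_
  · convert key using 1
    have hA' : latticeLim r c b = qPochInf (b * r) (r ^ 2) / qPochInf r (r ^ 2) *
        ((-r) ^ j * r ^ (-(j * (j + 1))) * qPochInf r (r ^ 2) ^ 2 / thetaProd r (-c)) := by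
      rw [hb, latticeLim_param h0 hc, show 2 - m = 1 + -2 * j by rw [hm]; ring, zpow_add₀ hr0,
        zpow_one, thetaProd_mul_zpow h0 h1 hr0, thetaProd_self h0]
    have hstep : qPochInf b (r ^ 2) = (1 - b) * qPochInf (b * r ^ 2) (r ^ 2) := qPochInf_step hp b
    have hbc : b / c = -r ^ (-m) := by rw [hb, param]; field_simp
    have hs : (-1 : ℝ) ^ (j - 1) = -(-1) ^ j := by
      rw [zpow_sub_one₀ (by norm_num)]; norm_num
    have hpow : r ^ (-(m ^ 2)) / r ^ (-((j + 1) * (2 * j + 1))) =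
        r * r ^ (-m) * r ^ (-((j - 1) * (j - 1 + 1))) * r ^ j * r ^ (-(j * (j + 1))) := by
      rw [← zpow_sub₀ hr0, ← zpow_one_add₀ hr0, ← zpow_add₀ hr0, ← zpow_add₀ hr0, ← zpow_add₀ hr0]
      congr 1
      rw [hm]; ring
    rw [halfNorm_eq h0 h1 hc hu, ← hb, hpow, hstep]
    rw [mul_one, mul_one, hbc, hA', hs, neg_zpow_eq r]
    have h11 := neg_one_zpow_mul_self j
    generalize qPochInf (b * r ^ 2) (r ^ 2) = A at *
    generalize qPochInf (b * r) (r ^ 2) = B at *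
    generalize qPochInf (r ^ 2) (r ^ 2) = W at *
    generalize r ^ (-m) = x1 at *
    generalize r ^ (-((j - 1) * (j - 1 + 1))) = x2 at *
    generalize r ^ (-(j * (j + 1))) = x3 at *
    generalize r ^ j = x4 at *
    generalize (-1 : ℝ) ^ j = e at *
    field_simp
    linear_combination (b - 1) * W ^ 2 * A * B * x1 * x2 * x3 * x4 * h11
  · refine ContinuousAt.neg (ContinuousAt.div_const ?_ _)
    have c2 : Continuous fun x : ℝ => qPochInf (b * r ^ 2 * x) (r ^ 2) :=
      hq.comp (continuous_const_mul (b * r ^ 2))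
    exact ((by fun_prop : Continuous fun x : ℝ => r * (b * x - 1) * latticeLim r c b *
      (b * x / c)).mul c2).continuousAt
  · intro x
    have e1 : b * x * r = param r c (m - 1) * x := by rw [← param_mul h0, ← hb]; ring
    have e2 := latticeLim_param_mul h0 hc (m - 1) x
    rw [← e1, show 2 - (m - 1) = -2 * (j - 1) by rw [hm]; ring,
      show b * x * r * r = b * r ^ 2 * x by ring] at e2
    rw [hA, e2]
    field_simp
    ring

theorem hasSum_param_sq_of_even (h0 : 0 < r) (h1 : r < 1) {c : ℝ} (hc : 0 < c) (j : ℤ) :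
    HasSum (fun k => latticeFun r c (param r c (2 * j)) k *
      latticeFun r c (param r c (2 * j)) k * latticeWeight r c k)
      (halfNorm r c (2 * j)) := by
  have hr0 := h0.ne'
  have hp := norm_sq_lt_one (norm_lt_one_of_pos h0 h1)
  have hq := continuous_qPochInf h0 h1
  have hR := qPochInf_ne_zero_of_norm_lt_one hp (norm_lt_one_of_pos h0 h1)
  have hθ := thetaProd_neg_pos h0 h1 hc
  set m : ℤ := 2 * j with hm
  set b := param r c m with hb
  -- For even m the roles are exchanged: the second product drops out, and the zero at x = 1 sits in
  -- L(bx).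
  have hA : latticeLim r c b = 0 := latticeLim_param_of_even h0 h1 hc (by rw [hm]; simp)
  have hu : thetaProd r b * thetaProd r (b * r) =
      c ^ m * r ^ (j - 2 * j * (j + 1)) * (thetaProd r (-c) * thetaProd r (-(c * r))) := by
    have e1 : b = -c * r ^ (-2 * j) := by
      rw [hb, param, show -m = -2 * j by rw [hm]; ring]
      ring
    have e2 : b * r = -(c * r) * r ^ (-2 * j) := by
      rw [e1]
      ring
    have e3 : c ^ m = c ^ j * c ^ j := by
      rw [← zpow_add₀ hc.ne']; congr 1; rw [hm]; ring
    have e4 : r ^ (j - 2 * j * (j + 1)) = r ^ j * r ^ (-(j * (j + 1))) * r ^ (-(j * (j + 1))) := by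
      rw [← zpow_add₀ hr0, ← zpow_add₀ hr0]; congr 1; ring
    rw [e2, e1, thetaProd_mul_zpow h0 h1 (neg_ne_zero.mpr (mul_pos hc h0).ne'),
      thetaProd_mul_zpow h0 h1 (neg_ne_zero.mpr hc.ne'), neg_neg, neg_neg, mul_zpow, e3, e4]
    ring
  have key := hasSum_latticeFun_sq' h0 h1 hc (param_ne_zero h0 hc m) (j := j - 1)
    (g := fun x => r * (b - 1) * latticeLim r c (b * r) * (b * x / c) *
      qPochInf (b * x * r) (r ^ 2) / (qPochInf r (r ^ 2) * thetaProd r (-c))) ?_ ?_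
  · convert key using 1
    have hA' : latticeLim r c (b * r) = qPochInf (b * r ^ 2) (r ^ 2) / qPochInf r (r ^ 2) *
        ((-r) ^ (j - 1) * r ^ (-((j - 1) * (j - 1 + 1))) * qPochInf r (r ^ 2) ^ 2 /
          thetaProd r (-c)) := by
      rw [hb, param_mul h0, latticeLim_param h0 hc, ← param_mul h0,
        show 2 - (m - 1) = 1 + -2 * (j - 1) by rw [hm]; ring, zpow_add₀ hr0,
        zpow_one, thetaProd_mul_zpow h0 h1 hr0, thetaProd_self h0, mul_assoc, ← sq]
    have hstep : qPochInf b (r ^ 2) = (1 - b) * qPochInf (b * r ^ 2) (r ^ 2) := qPochInf_step hp b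
    have hbc : b / c = -r ^ (-m) := by rw [hb, param]; field_simp
    have hpow : r ^ (-(m ^ 2)) / r ^ (j - 2 * j * (j + 1)) =
        r * r ^ (-m) * r ^ (-((j - 1) * (j - 1 + 1))) * r ^ (j - 1) *
          r ^ (-((j - 1) * (j - 1 + 1))) := by
      rw [← zpow_sub₀ hr0, ← zpow_one_add₀ hr0, ← zpow_add₀ hr0, ← zpow_add₀ hr0, ← zpow_add₀ hr0]
      congr 1
      rw [hm]; ring
    rw [halfNorm_eq h0 h1 hc hu, ← hb, hpow, hstep]
    rw [mul_one, hbc, hA', neg_zpow_eq r]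
    have h11 := neg_one_zpow_mul_self (j - 1)
    generalize qPochInf (b * r ^ 2) (r ^ 2) = A at *
    generalize qPochInf (b * r) (r ^ 2) = B at *
    generalize qPochInf (r ^ 2) (r ^ 2) = W at *
    generalize r ^ (-m) = x1 at *
    generalize r ^ (-((j - 1) * (j - 1 + 1))) = x2 at *
    generalize r ^ (j - 1) = x4 at *
    generalize (-1 : ℝ) ^ (j - 1) = e at *
    field_simp
    linear_combination (b - 1) * W ^ 2 * A * B * x1 * x2 ^ 2 * x4 * h11
  · refine ContinuousAt.div_const ?_ _
    have c2 : Continuous fun x : ℝ => qPochInf (b * x * r) (r ^ 2) :=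
      hq.comp (by fun_prop : Continuous fun x : ℝ => b * x * r)
    exact ((by fun_prop : Continuous fun x : ℝ => r * (b - 1) * latticeLim r c (b * r) *
      (b * x / c)).mul c2).continuousAt
  · intro x
    have e1 := latticeLim_param_mul h0 hc m x
    rw [← hb, show 2 - m = -2 * (j - 1) by rw [hm]; ring] at e1
    rw [hA, e1]
    field_simp
    ring

theorem hasSum_param_sq (h0 : 0 < r) (h1 : r < 1) {c : ℝ} (hc : 0 < c) (m : ℤ) :
    HasSum (fun k => latticeFun r c (param r c m) k * latticeFun r c (param r c m) k *
      latticeWeight r c k) (halfNorm r c m) := by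
  obtain ⟨j, rfl | rfl⟩ := m.even_or_odd'
  · exact hasSum_param_sq_of_even h0 h1 hc j
  · exact hasSum_param_sq_of_odd h0 h1 hc j

/-- Eigenfunctions with different parameters and the same parity are orthogonal. -/
theorem hasSum_latticeFun_mul_zero (h0 : 0 < r) (h1 : r < 1) {c : ℝ} (hc : 0 < c) {b b' : ℝ}
    (hb : b ≠ 0) (hb' : b' ≠ 0) (hne : b ≠ b')
    (h : latticeLim r c b = 0 ∧ latticeLim r c b' = 0 ∨
      (b - 1) * latticeLim r c (b * r) = 0 ∧ (b' - 1) * latticeLim r c (b' * r) = 0) :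
    HasSum (fun k => latticeFun r c b k * latticeFun r c b' k * latticeWeight r c k) 0 := by
  have hk : c * (1 / b' - 1 / b) ≠ 0 := by
    refine mul_ne_zero hc.ne' (sub_ne_zero.mpr fun h => hne ?_)
    rw [one_div, one_div, inv_inj] at h
    exact h.symm
  have hz : r * ((b - 1) * (latticeLim r c (b * r) * latticeLim r c b') -
      (b' - 1) * (latticeLim r c b * latticeLim r c (b' * r))) = 0 := by
    rcases h with ⟨h2, h3⟩ | ⟨h2, h3⟩
    · rw [h2, h3]; ring
    · linear_combination r * latticeLim r c b' * h2 - r * latticeLim r c b * h3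
  have hs := hasSum_latticeFun_mul h0 h1 hc hb hb'
  rw [hz] at hs
  simpa only [mul_zero, inv_mul_cancel_left₀ hk] using hs.mul_left (c * (1 / b' - 1 / b))⁻¹

end Norms

/-! ### The eigenfunctions of the oscillator in terms of `latticeFun` -/

section Conversion

variable {q : ℝ}

theorem base_pos (hq : 1 < q) : 0 < q ^ (-2 : ℤ) := zpow_pos (by linarith) _

theorem base_lt_one (hq : 1 < q) : q ^ (-2 : ℤ) < 1 := zpow_lt_one_of_neg₀ hq (by norm_num)

theorem base_sq (q : ℝ) : (q ^ (-2 : ℤ)) ^ 2 = q ^ (-4 : ℤ) := by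
  rw [← zpow_natCast, ← zpow_mul]; norm_num

theorem base_zpow (q : ℝ) (k : ℤ) : (q ^ (-2 : ℤ)) ^ k = q ^ (-2 * k) := (zpow_mul q _ _).symm

theorem cst_pos (hq : 1 < q) (γ : ℝ) : 0 < cst q γ := Real.rpow_pos_of_pos (by linarith) _

theorem unit_sq (σ : ℤˣ) : (((σ : ℤ) : ℝ)) ^ 2 = 1 := by
  rcases Int.units_eq_one_or σ with rfl | rfl <;> norm_num

theorem pt_sq (hq : 1 < q) (γ : ℝ) (σ : ℤˣ) (k : ℤ) :
    pt q γ σ k ^ 2 = cst q γ * (q ^ (-2 : ℤ)) ^ (2 * k) := by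
  rw [pt, mul_pow, mul_pow, unit_sq, Real.sq_sqrt (cst_pos hq γ).le, base_zpow, one_mul,
    ← zpow_natCast (q ^ _), ← zpow_mul]
  congr 2
  push_cast
  ring

theorem node_eq (hq : 1 < q) (γ : ℝ) (σ : ℤˣ) (k : ℤ) :
    -(q ^ (-4 : ℤ) / pt q γ σ k ^ 2) = node (q ^ (-2 : ℤ)) (cst q γ) k := by
  have hr := (base_pos hq).ne'
  rw [pt_sq hq, node, mul_sub, zpow_sub₀ hr, ← base_sq]
  have hc := (cst_pos hq γ).ne'
  have : (q ^ (-2 : ℤ)) ^ (2 * k) ≠ 0 := zpow_ne_zero _ hr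
  norm_cast
  field_simp

theorem param_eq (hq : 1 < q) (γ : ℝ) (m : ℤ) :
    param (q ^ (-2 : ℤ)) (cst q γ) m = -q ^ (2 * (m : ℝ) - 2 * γ) := by
  have hq0 : 0 < q := by linarith
  rw [param, cst, base_zpow, ← Real.rpow_intCast q (-2 * -m), ← Real.rpow_add hq0]
  congr 2
  push_cast
  ring

theorem param_mul_base (hq : 1 < q) (γ : ℝ) (m : ℤ) :
    param (q ^ (-2 : ℤ)) (cst q γ) m * q ^ (-2 : ℤ) = -q ^ (2 * (m : ℝ) - 2 * γ - 2) := by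
  have hq0 : 0 < q := by linarith
  rw [param_eq hq, neg_mul, ← Real.rpow_intCast q (-2), ← Real.rpow_add hq0]
  congr 2
  push_cast
  ring

theorem neg_eps_eq (hq : 1 < q) (γ : ℝ) (m : ℤ) :
    -eps q γ m = (param (q ^ (-2 : ℤ)) (cst q γ) m)⁻¹ := by
  have hq0 : 0 < q := by linarith
  rw [param_eq hq, eps, inv_neg, ← Real.rpow_neg hq0.le]
  congr 2
  ring

theorem phi21_node (hq : 1 < q) {c : ℝ} (hc : 0 < c) (b : ℝ) (k : ℤ) :
    (b ^ (-k) : ℝ) * phi21 ((b * q ^ (-2 : ℤ) : ℝ) : ℂ) (b : ℂ) 0 ((q ^ (-4 : ℤ) : ℝ) : ℂ)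
      ((node (q ^ (-2 : ℤ)) c k : ℝ) : ℂ) = ((latticeFun (q ^ (-2 : ℤ)) c b k : ℝ) : ℂ) := by
  have hz := node_neg (base_pos hq) hc k
  rw [← base_sq, phi21_ofReal (base_pos hq) (base_lt_one hq) b (hz.trans one_pos), latticeFun,
    Complex.ofReal_mul]

theorem kPhi_eq (hq : 1 < q) (γ : ℝ) (m : ℤ) (σ : ℤˣ) (k : ℤ) :
    (((-eps q γ m) ^ k : ℝ) : ℂ) * kPhi q γ m (pt q γ σ k) =
      ((latticeFun (q ^ (-2 : ℤ)) (cst q γ) (param (q ^ (-2 : ℤ)) (cst q γ) m) k : ℝ) : ℂ) := by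
  rw [← phi21_node hq (cst_pos hq γ), kPhi,
    param_mul_base hq, neg_eps_eq hq, inv_zpow', node_eq hq, param_eq hq]

theorem kTilde_eq (hq : 1 < q) (γ : ℝ) (m : ℤ) (σ : ℤˣ) (k : ℤ) :
    kTilde q γ m σ k = (((((σ ^ (m + 1) : ℤˣ) : ℤ) : ℝ) *
      latticeFun (q ^ (-2 : ℤ)) (cst q γ) (param (q ^ (-2 : ℤ)) (cst q γ) m) k : ℝ) : ℂ) := by
  rw [kTilde, Complex.ofReal_mul, Complex.ofReal_mul, mul_assoc, kPhi_eq hq]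

/-- The factor r^{kn} of x^n equals b^{-k} for b = r^{-n}, which places h̃_n in the same family as
the k̃_m. -/
theorem hTilde_eq (hq : 1 < q) (γ : ℝ) (n : ℕ) (σ : ℤˣ) (k : ℤ) :
    hTilde q n (pt q γ σ k) = (((((σ ^ n : ℤˣ) : ℤ) : ℝ) * (√(cst q γ) ^ n *
      latticeFun (q ^ (-2 : ℤ)) (cst q γ) ((q ^ (-2 : ℤ)) ^ (-(n : ℤ))) k) : ℝ) : ℂ) := by
  have hq0 : q ≠ 0 := by linarith
  have hb : (q ^ (-2 : ℤ)) ^ (-(n : ℤ)) = q ^ (2 * (n : ℤ)) := by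
    rw [base_zpow]; congr 1; ring
  have hbr : q ^ (2 * (n : ℤ)) * q ^ (-2 : ℤ) = q ^ (2 * (n : ℤ) - 2) := by
    rw [← zpow_add₀ hq0]; rfl
  have hpt : pt q γ σ k ^ n = (((σ ^ n : ℤˣ) : ℤ) : ℝ) * √(cst q γ) ^ n *
      (q ^ (2 * (n : ℤ))) ^ (-k) := by
    rw [pt, mul_pow, mul_pow, ← zpow_natCast (q ^ _), ← zpow_mul, ← zpow_mul]
    push_cast
    congr 2
    ring
  rw [hTilde, node_eq hq, hpt, ← mul_assoc, Complex.ofReal_mul, Complex.ofReal_mul _ (latticeFun _ _ _ _),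
    hb, ← phi21_node hq (cst_pos hq γ), hbr, mul_assoc]

theorem weight_eq (q γ : ℝ) (k : ℤ) :
    weight q γ k = latticeWeight (q ^ (-2 : ℤ)) (cst q γ) k := by
  rw [weight, latticeWeight, base_sq, base_zpow, base_zpow]
  congr 5
  ring

/-- Separates even and odd powers of r; the stated norm uses base q^{-2}, all other products base
q^{-4}. -/
theorem qPochInf_eq_mul_qPochInf_sq {r : ℝ} (hr : ‖r‖ < 1) (a : ℝ) :
    qPochInf a r = qPochInf a (r ^ 2) * qPochInf (a * r) (r ^ 2) := by
  have hp := norm_sq_lt_one hr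
  have h : ∀ n, qPoch a r (2 * n) = qPoch a (r ^ 2) n * qPoch (a * r) (r ^ 2) n := fun n => by
    induction n with
    | zero => simp
    | succ n ih =>
      rw [show 2 * (n + 1) = 2 * n + 1 + 1 by ring, qPoch_succ, qPoch_succ, ih, qPoch_succ, qPoch_succ]
      ring
  have h2 : Tendsto (fun n => 2 * n) atTop (atTop : Filter ℕ) :=
    tendsto_id.const_mul_atTop' two_pos
  refine tendsto_nhds_unique ((tendsto_qPoch hr a).comp h2) ?_
  simp only [Function.comp_def, h]
  exact (tendsto_qPoch hp a).mul (tendsto_qPoch hp (a * r))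

/-- M_c is (p;p)_∞² θ(-cr)/θ(-c) with the theta functions written out. -/
theorem normSq_eq (hq : 1 < q) (γ : ℝ) (m : ℤ) :
    normSq q γ m = 2 * halfNorm (q ^ (-2 : ℤ)) (cst q γ) m := by
  have hr := norm_lt_one_of_pos (base_pos hq) (base_lt_one hq)
  have hr0 := (base_pos hq).ne'
  have hc := (cst_pos hq γ).ne'
  have e1 : q ^ (2 * m ^ 2) = (q ^ (-2 : ℤ)) ^ (-(m ^ 2)) := by
    rw [base_zpow]; congr 1; ring
  have e2 : q ^ (-2 * m - 2) = (q ^ (-2 : ℤ)) ^ (m + 1) := by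
    rw [base_zpow]; congr 1; ring
  rw [normSq, halfNorm, e1, e2, qPochInf_eq_mul_qPochInf_sq hr, Mc, ← base_sq]
  generalize q ^ (-2 : ℤ) = r at *
  generalize cst q γ = c at *
  have e3 : thetaProd r (-(c * r)) =
      qPochInf (-(c⁻¹ * r)) (r ^ 2) * qPochInf (-(c * r)) (r ^ 2) := by
    rw [thetaProd, mul_comm, show r ^ 2 / -(c * r) = -(c⁻¹ * r) by field_simp]
  have e4 : thetaProd r (-c) = qPochInf (-c) (r ^ 2) * qPochInf (-(c⁻¹ * r ^ 2)) (r ^ 2) := by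
    rw [thetaProd, show r ^ 2 / -c = -(c⁻¹ * r ^ 2) by field_simp]
  rw [e3, e4]
  ring

/-- Summation over both halves of the lattice. -/
theorem hasSum_prod_units {g : ℤ → ℝ} {S : ℝ} (hg : HasSum g S) (χ : ℤˣ → ℝ) :
    HasSum (fun i : ℤ × ℤˣ => ((g i.1 * χ i.2 : ℝ) : ℂ)) ((S * (χ 1 + χ (-1)) : ℝ) : ℂ) := by
  have hχ : HasSum χ (χ 1 + χ (-1)) := by
    have := hasSum_fintype χ
    have hu : (Finset.univ : Finset ℤˣ) = {1, -1} := by decide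
    rwa [hu, Finset.sum_pair (by decide)] at this
  exact Complex.hasSum_ofReal.mpr
    (hg.mul hχ (summable_mul_of_summable_norm hg.summable.norm hχ.summable.norm))

theorem unit_zpow_sum (l : ℤ) : ((((1 : ℤˣ) ^ l : ℤˣ) : ℤ) : ℝ) + ((((-1 : ℤˣ) ^ l : ℤˣ) : ℤ) : ℝ) =
    if Even l then 2 else 0 := by
  split_ifs with h
  · rw [one_zpow, h.neg_one_zpow]; norm_num
  · rw [one_zpow, (Int.not_even_iff_odd.mp h).neg_one_zpow]; norm_num

end Conversion

/-! ### Orthogonality on the extended lattice -/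

section Orthogonality

variable {q : ℝ}

theorem kTilde_equation (hq : 1 < q) (γ : ℝ) (m : ℤ) (σ : ℤˣ) (k : ℤ) :
    ((q + q⁻¹ - q * eps q γ m * pt q γ σ k ^ 2 : ℝ) : ℂ) * kTilde q γ m σ k
      - (q : ℂ)⁻¹ * kTilde q γ m σ (k - 1)
      - (q : ℂ) * ((1 + pt q γ σ k ^ 2 : ℝ) : ℂ) * kTilde q γ m σ (k + 1) = 0 := by
  have hq0 : q ≠ 0 := by linarith
  have hb := param_ne_zero (base_pos hq) (cst_pos hq γ) m
  have h := latticeFun_recurrence (base_pos hq) (base_lt_one hq) (cst_pos hq γ) hb k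
  have hε : eps q γ m = -(param (q ^ (-2 : ℤ)) (cst q γ) m)⁻¹ := by
    rw [← neg_eps_eq hq, neg_neg]
  have hqr : q⁻¹ = q * q ^ (-2 : ℤ) := by
    rw [← zpow_one_add₀ hq0, ← zpow_neg_one]; norm_num
  rw [kTilde_eq hq, kTilde_eq hq, kTilde_eq hq, pt_sq hq, hε, ← Complex.ofReal_inv, hqr]
  generalize q ^ (-2 : ℤ) = r at *
  norm_cast
  generalize (((σ ^ (m + 1) : ℤˣ) : ℤ) : ℝ) = s
  rw [div_eq_mul_inv] at h
  linear_combination q * s * h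

theorem kTilde_mul_kTilde (hq : 1 < q) (γ : ℝ) (m n : ℤ) (σ : ℤˣ) (k : ℤ) :
    kTilde q γ m σ k * kTilde q γ n σ k * (weight q γ k : ℂ) =
      ((latticeFun (q ^ (-2 : ℤ)) (cst q γ) (param (q ^ (-2 : ℤ)) (cst q γ) m) k *
        latticeFun (q ^ (-2 : ℤ)) (cst q γ) (param (q ^ (-2 : ℤ)) (cst q γ) n) k *
        latticeWeight (q ^ (-2 : ℤ)) (cst q γ) k *
        (((σ ^ (m + 1 + (n + 1)) : ℤˣ) : ℤ) : ℝ) : ℝ) : ℂ) := by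
  rw [kTilde_eq hq, kTilde_eq hq, weight_eq, zpow_add σ (m + 1) (n + 1), Units.val_mul]
  push_cast
  ring

theorem param_injective (h0 : 0 < q) (h1 : q < 1) {c : ℝ} (hc : 0 < c) :
    Function.Injective (param q c) := fun m n h => by
  have h2 : q ^ (-m) = q ^ (-n) := mul_left_cancel₀ hc.ne' (neg_injective h)
  exact neg_injective (zpow_right_injective₀ h0 h1.ne h2)

theorem hasSum_kTilde (hq : 1 < q) (γ : ℝ) (m n : ℤ) :
    HasSum (fun i : ℤ × ℤˣ =>
      kTilde q γ m i.2 i.1 * kTilde q γ n i.2 i.1 * (weight q γ i.1 : ℂ))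
      (if m = n then (normSq q γ m : ℂ) else 0) := by
  have h0 := base_pos hq
  have h1 := base_lt_one hq
  have hc := cst_pos hq γ
  have hm := param_ne_zero h0 hc m
  have hn := param_ne_zero h0 hc n
  simp only [kTilde_mul_kTilde hq]
  split_ifs with hmn
  · subst hmn
    have := hasSum_prod_units (hasSum_param_sq h0 h1 hc m)
      (fun σ => (((σ ^ (m + 1 + (m + 1)) : ℤˣ) : ℤ) : ℝ))
    rwa [unit_zpow_sum, if_pos (Even.add_self _), mul_comm _ (2 : ℝ), ← normSq_eq hq] at this
  -- For equal parities the boundary term vanishes on each half of the lattice; for opposite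
  -- parities the halves cancel.
  · by_cases hev : Even (m + 1 + (n + 1))
    · have hz := hasSum_latticeFun_mul_zero h0 h1 hc hm hn
        ((param_injective h0 h1 hc).ne hmn) (by
          rw [param_mul h0, param_mul h0]
          rcases Int.even_or_odd m with he | ho
          · refine Or.inl ⟨latticeLim_param_of_even h0 h1 hc he,
              latticeLim_param_of_even h0 h1 hc ?_⟩
            grind
          · refine Or.inr ⟨mul_eq_zero_of_right _ (latticeLim_param_of_even h0 h1 hc ?_),
              mul_eq_zero_of_right _ (latticeLim_param_of_even h0 h1 hc ?_)⟩
            · grind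
            · grind)
      simpa using hasSum_prod_units hz (fun σ => (((σ ^ (m + 1 + (n + 1)) : ℤˣ) : ℤ) : ℝ))
    · have := hasSum_prod_units (summable_latticeFun_mul h0 h1 hc hm hn).hasSum
        (fun σ => (((σ ^ (m + 1 + (n + 1)) : ℤˣ) : ℤ) : ℝ))
      rwa [unit_zpow_sum, if_neg hev, mul_zero, Complex.ofReal_zero] at this

theorem qPochInf_eq_zero {p a : ℝ} (hp : ‖p‖ < 1) {i : ℕ} (h : a * p ^ i = 1) :
    qPochInf a p = 0 := by
  rw [qPochInf_eq hp a (i + 1), qPoch_succ, h, sub_self, mul_zero, zero_mul]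

/-- For n = 2i + 1 the factor with index i of (br;p)_∞ is zero. -/
theorem latticeLim_zpow_neg_of_odd (h0 : 0 < q) (h1 : q < 1) (c : ℝ) {n : ℕ} (hn : Odd n) :
    latticeLim q c (q ^ (-(n : ℤ))) = 0 := by
  obtain ⟨i, rfl⟩ := hn
  have hp := norm_sq_lt_one (norm_lt_one_of_pos h0 h1)
  have h : q ^ (-((2 * i + 1 : ℕ) : ℤ)) * q * (q ^ 2) ^ i = 1 := by
    rw [← pow_mul, ← zpow_add_one₀ h0.ne', ← zpow_natCast, ← zpow_add₀ h0.ne',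
      show -((2 * i + 1 : ℕ) : ℤ) + 1 + ((2 * i : ℕ) : ℤ) = 0 by push_cast; ring, zpow_zero]
  rw [latticeLim, qPochInf_eq_zero hp h]
  simp

/-- Multiplying by the base lowers n to the odd number n - 1; for n = 0 it is the prefactor b - 1
that vanishes. -/
theorem latticeLim_zpow_neg_mul_of_even (h0 : 0 < q) (h1 : q < 1) (c : ℝ) {n : ℕ} (hn : Even n) :
    (q ^ (-(n : ℤ)) - 1) * latticeLim q c (q ^ (-(n : ℤ)) * q) = 0 := by
  cases n with
  | zero => simp
  | succ n =>
    have hodd : Odd n := by grind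
    have : q ^ (-((n + 1 : ℕ) : ℤ)) * q = q ^ (-(n : ℤ)) := by
      rw [← zpow_add_one₀ h0.ne']
      congr 1
      push_cast
      ring
    rw [this, latticeLim_zpow_neg_of_odd h0 h1 c hodd, mul_zero]

theorem hTilde_mul_kTilde (hq : 1 < q) (γ : ℝ) (n : ℕ) (m : ℤ) (σ : ℤˣ) (k : ℤ) :
    hTilde q n (pt q γ σ k) * kTilde q γ m σ k * (weight q γ k : ℂ) =
      ((√(cst q γ) ^ n * (latticeFun (q ^ (-2 : ℤ)) (cst q γ) ((q ^ (-2 : ℤ)) ^ (-(n : ℤ))) k *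
        latticeFun (q ^ (-2 : ℤ)) (cst q γ) (param (q ^ (-2 : ℤ)) (cst q γ) m) k *
        latticeWeight (q ^ (-2 : ℤ)) (cst q γ) k) *
        (((σ ^ ((n : ℤ) + (m + 1)) : ℤˣ) : ℤ) : ℝ) : ℝ) : ℂ) := by
  rw [hTilde_eq hq, kTilde_eq hq, weight_eq, zpow_add σ (n : ℤ) (m + 1), Units.val_mul, zpow_natCast]
  push_cast
  ring

theorem hasSum_hTilde_mul_kTilde (hq : 1 < q) (γ : ℝ) (n : ℕ) (m : ℤ) :
    HasSum (fun i : ℤ × ℤˣ =>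
      hTilde q n (pt q γ i.2 i.1) * kTilde q γ m i.2 i.1 * (weight q γ i.1 : ℂ)) 0 := by
  have h0 := base_pos hq
  have h1 := base_lt_one hq
  have hc := cst_pos hq γ
  have hm := param_ne_zero h0 hc m
  have hn : (q ^ (-2 : ℤ)) ^ (-(n : ℤ)) ≠ 0 := zpow_ne_zero _ h0.ne'
  have hne : (q ^ (-2 : ℤ)) ^ (-(n : ℤ)) ≠ param (q ^ (-2 : ℤ)) (cst q γ) m := by
    have e1 : 0 < (q ^ (-2 : ℤ)) ^ (-(n : ℤ)) := zpow_pos h0 _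
    have e2 : 0 < cst q γ * (q ^ (-2 : ℤ)) ^ (-m) := mul_pos hc (zpow_pos h0 _)
    rw [param]
    linarith
  simp only [hTilde_mul_kTilde hq]
  by_cases hev : Even ((n : ℤ) + (m + 1))
  · have hz := (hasSum_latticeFun_mul_zero h0 h1 hc hn hm hne (by
      rw [param_mul h0]
      rcases Nat.even_or_odd n with he | ho
      · refine Or.inr ⟨latticeLim_zpow_neg_mul_of_even h0 h1 _ he,
          mul_eq_zero_of_right _ (latticeLim_param_of_even h0 h1 hc ?_)⟩
        grind
      · refine Or.inl ⟨latticeLim_zpow_neg_of_odd h0 h1 _ ho,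
          latticeLim_param_of_even h0 h1 hc ?_⟩
        grind)).mul_left (√(cst q γ) ^ n)
    simpa using hasSum_prod_units hz (fun σ => (((σ ^ ((n : ℤ) + (m + 1)) : ℤˣ) : ℤ) : ℝ))
  · have := hasSum_prod_units
      ((summable_latticeFun_mul h0 h1 hc hn hm).hasSum.mul_left (√(cst q γ) ^ n))
      (fun σ => (((σ ^ ((n : ℤ) + (m + 1)) : ℤˣ) : ℤ) : ℝ))
    rwa [unit_zpow_sum, if_neg hev, mul_zero, Complex.ofReal_zero] at this

/-- The unimodular factor by which `kPrincipal` differs from `|ε|^k ₂φ₁`. -/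
noncomputable def phase (γ : ℝ) (m : ℤ) (σ : ℤˣ) : ℂ :=
  if σ = 1 then Complex.exp (Real.pi * Complex.I * (((m : ℝ) - γ : ℝ) : ℂ)) else 1

/-- Conjugation cancels γ and leaves e^{iπ(n-m)} = (-1)^{m+n} for σ = 1. For σ = -1 both phases are
1, and the two signs on the right cancel. -/
theorem conj_phase_mul_phase (γ : ℝ) (m n : ℤ) (σ : ℤˣ) :
    (starRingEnd ℂ) (phase γ m σ) * phase γ n σ =
      (-1) ^ (m + n) * (((σ ^ (m + 1 + (n + 1)) : ℤˣ) : ℤ) : ℂ) := by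
  rcases Int.units_eq_one_or σ with rfl | rfl
  · rw [phase, phase, if_pos rfl, if_pos rfl, ← Complex.exp_conj, ← Complex.exp_add, one_zpow]
    simp only [map_mul, Complex.conj_I, Complex.conj_ofReal]
    have : (Real.pi : ℂ) * -Complex.I * (((m : ℝ) - γ : ℝ) : ℂ) +
        Real.pi * Complex.I * (((n : ℝ) - γ : ℝ) : ℂ) = ((n - m : ℤ) : ℂ) * (Real.pi * Complex.I) := by
      push_cast
      ring
    rw [this, Complex.exp_int_mul, Complex.exp_pi_mul_I, show m + n = n - m + 2 * m by ring,
      zpow_add₀ (by norm_num : (-1 : ℂ) ≠ 0), zpow_mul]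
    norm_num
  · rw [phase, phase, if_neg (by decide), if_neg (by decide)]
    rcases Int.even_or_odd (m + n) with h | h
    · rw [h.neg_one_zpow, show m + 1 + (n + 1) = m + n + 2 by ring, (h.add even_two).neg_one_zpow]
      simp
    · rw [h.neg_one_zpow, show m + 1 + (n + 1) = m + n + 2 by ring,
        (h.add_even even_two).neg_one_zpow]
      simp

theorem abs_prefactor (hq : 1 < q) (γ : ℝ) (m k : ℤ) :
    (√(cst q γ) * q ^ (-2 * k)) ^ ((m : ℝ) - γ) * √(cst q γ) ^ (γ - (m : ℝ)) = eps q γ m ^ k := by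
  have hq0 : 0 < q := by linarith
  have hs : 0 < √(cst q γ) := Real.sqrt_pos.mpr (cst_pos hq γ)
  rw [Real.mul_rpow hs.le (zpow_pos hq0 _).le, mul_right_comm, ← Real.rpow_add hs,
    show (m : ℝ) - γ + (γ - m) = 0 by ring, Real.rpow_zero, one_mul, eps,
    ← Real.rpow_intCast q (-2 * k), ← Real.rpow_mul hq0.le, ← Real.rpow_intCast _ k,
    ← Real.rpow_mul hq0.le]
  congr 1
  push_cast
  ring

theorem kPrincipal_eq (hq : 1 < q) (γ : ℝ) (m : ℤ) (σ : ℤˣ) (k : ℤ) :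
    kPrincipal q γ m (pt q γ σ k) = phase γ m σ * ((eps q γ m ^ k : ℝ) : ℂ) *
      kPhi q γ m (pt q γ σ k) := by
  have hq0 : 0 < q := by linarith
  have hx : 0 ≤ √(cst q γ) * q ^ (-2 * k) :=
    mul_nonneg (Real.sqrt_nonneg _) (zpow_pos hq0 _).le
  rw [kPrincipal, ← abs_prefactor hq, Complex.ofReal_mul, Complex.ofReal_cpow hx, ← mul_assoc]
  congr 2
  rcases Int.units_eq_one_or σ with rfl | rfl
  · rw [phase, if_pos rfl]
    have hpt : -pt q γ 1 k = -(√(cst q γ) * q ^ (-2 * k)) := by simp [pt]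
    rw [hpt, Complex.ofReal_cpow_of_nonpos (neg_nonpos.mpr hx), Complex.ofReal_neg, neg_neg,
      mul_comm]
  · rw [phase, if_neg (by decide)]
    have hpt : -pt q γ (-1) k = √(cst q γ) * q ^ (-2 * k) := by simp [pt]
    rw [hpt, one_mul]

theorem conj_kPrincipal_mul (hq : 1 < q) (γ : ℝ) (m n : ℤ) (σ : ℤˣ) (k : ℤ) :
    (starRingEnd ℂ) (kPrincipal q γ m (pt q γ σ k)) * kPrincipal q γ n (pt q γ σ k) =
      (-1) ^ (m + n) * (kTilde q γ m σ k * kTilde q γ n σ k) := by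
  have hconj : (starRingEnd ℂ) (kPhi q γ m (pt q γ σ k)) = kPhi q γ m (pt q γ σ k) := by
    have h := kPhi_eq hq γ m σ k
    have hne : (((-eps q γ m) ^ k : ℝ) : ℂ) ≠ 0 := by
      rw [neg_eps_eq hq]
      exact_mod_cast zpow_ne_zero k (inv_ne_zero (param_ne_zero (base_pos hq) (cst_pos hq γ) m))
    rw [eq_comm, mul_comm, ← div_eq_iff hne] at h
    rw [← h, ← Complex.ofReal_div, Complex.conj_ofReal]
  have hu : (((σ ^ (m + 1 + (n + 1)) : ℤˣ) : ℤ) : ℂ) =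
      (((σ ^ (m + 1) : ℤˣ) : ℤ) : ℂ) * (((σ ^ (n + 1) : ℤˣ) : ℤ) : ℂ) := by
    rw [zpow_add σ (m + 1) (n + 1), Units.val_mul, Int.cast_mul]
  have hε : (((-eps q γ m) ^ k : ℝ) : ℂ) * (((-eps q γ n) ^ k : ℝ) : ℂ) =
      ((eps q γ m ^ k : ℝ) : ℂ) * ((eps q γ n ^ k : ℝ) : ℂ) := by
    rw [← Complex.ofReal_mul, ← Complex.ofReal_mul, ← mul_zpow, ← mul_zpow, neg_mul_neg]
  have hph := conj_phase_mul_phase γ m n σ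
  rw [hu] at hph
  rw [kPrincipal_eq hq, kPrincipal_eq hq, map_mul, map_mul, Complex.conj_ofReal, hconj, kTilde,
    kTilde, Complex.ofReal_mul, Complex.ofReal_mul, Complex.ofReal_intCast,
    Complex.ofReal_intCast]
  generalize kPhi q γ m (pt q γ σ k) = A at *
  generalize kPhi q γ n (pt q γ σ k) = B at *
  linear_combination ((eps q γ m ^ k : ℝ) : ℂ) * ((eps q γ n ^ k : ℝ) : ℂ) * A * B * hph -
    (-1) ^ (m + n) * (((σ ^ (m + 1) : ℤˣ) : ℤ) : ℂ) * (((σ ^ (n + 1) : ℤˣ) : ℤ) : ℂ) * A * B * hε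

/-- The sign (-1)^{m+n} relating the products to those of the k̃_m is 1 on the diagonal and
multiplies 0 elsewhere. -/
theorem hasSum_kPrincipal (hq : 1 < q) (γ : ℝ) (m n : ℤ) :
    HasSum (fun i : ℤ × ℤˣ =>
      (starRingEnd ℂ) (kPrincipal q γ m (pt q γ i.2 i.1)) * kPrincipal q γ n (pt q γ i.2 i.1) *
        (weight q γ i.1 : ℂ))
      (if m = n then (normSq q γ m : ℂ) else 0) := by
  have h := (hasSum_kTilde hq γ m n).mul_left ((-1) ^ (m + n))
  simp only [conj_kPrincipal_mul hq, mul_assoc] at h ⊢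
  have hval : (-1 : ℂ) ^ (m + n) * (if m = n then (normSq q γ m : ℂ) else 0) =
      if m = n then (normSq q γ m : ℂ) else 0 := by
    split_ifs with hmn
    · rw [hmn, (Even.add_self n).neg_one_zpow, one_mul]
    · rw [mul_zero]
  rwa [hval] at h

end Orthogonality

end QOscillator

theorem mainTheorem2 (q γ : ℝ) (hq : 1 < q) :
    -- all the values on the extended lattice are real
    (∀ (m : ℤ) (σ : ℤˣ) (k : ℤ), (QOscillator.kTilde q γ m σ k).im = 0) ∧
    (∀ (n : ℕ) (σ : ℤˣ) (k : ℤ), (QOscillator.hTilde q n (QOscillator.pt q γ σ k)).im = 0) ∧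
    -- `k̃_m` solves the eigenvalue equation with `ε = q^{2γ-2m}` on the extended lattice
    (∀ (m : ℤ) (σ : ℤˣ) (k : ℤ),
      ((q + q⁻¹ - q * QOscillator.eps q γ m * QOscillator.pt q γ σ k ^ 2 : ℝ) : ℂ) *
            QOscillator.kTilde q γ m σ k
          - (q : ℂ)⁻¹ * QOscillator.kTilde q γ m σ (k - 1)
          - (q : ℂ) * ((1 + QOscillator.pt q γ σ k ^ 2 : ℝ) : ℂ) *
            QOscillator.kTilde q γ m σ (k + 1) = 0) ∧
    -- orthogonality and norms of the `k̃_m`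
    (∀ m n : ℤ,
      HasSum (fun i : ℤ × ℤˣ =>
          QOscillator.kTilde q γ m i.2 i.1 * QOscillator.kTilde q γ n i.2 i.1 *
            (QOscillator.weight q γ i.1 : ℂ))
        (if m = n then (QOscillator.normSq q γ m : ℂ) else 0)) ∧
    -- orthogonality of `h̃_n` and `k̃_m`
    (∀ (n : ℕ) (m : ℤ),
      HasSum (fun i : ℤ × ℤˣ =>
          QOscillator.hTilde q n (QOscillator.pt q γ i.2 i.1) *
            QOscillator.kTilde q γ m i.2 i.1 * (QOscillator.weight q γ i.1 : ℂ)) 0) ∧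
    -- with the prefactor `(-x)^{m-γ} √c^{γ-m}` (principal value of the power) and complex conjugation
    -- in the first argument, orthogonality and norms of the `k̃_m` hold as well
    (∀ m n : ℤ,
      HasSum (fun i : ℤ × ℤˣ =>
          (starRingEnd ℂ) (QOscillator.kPrincipal q γ m (QOscillator.pt q γ i.2 i.1)) *
            QOscillator.kPrincipal q γ n (QOscillator.pt q γ i.2 i.1) *
            (QOscillator.weight q γ i.1 : ℂ))
        (if m = n then (QOscillator.normSq q γ m : ℂ) else 0)) := by
  refine ⟨fun m σ k => ?_, fun n σ k => ?_, QOscillator.kTilde_equation hq γ,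
    QOscillator.hasSum_kTilde hq γ, QOscillator.hasSum_hTilde_mul_kTilde hq γ,
    QOscillator.hasSum_kPrincipal hq γ⟩
  · rw [QOscillator.kTilde_eq hq, Complex.ofReal_im]
  · rw [QOscillator.hTilde_eq hq, Complex.ofReal_im]
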